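/- Setting. All manifolds are Hausdorff (not necessarily connected or paracompact), and all locally convex spaces are Hausdorff and sequentially complete. $V$ and $W$ are finite-dimensional $C^\infty$ manifolds, possibly with boundary, with $\dim_{\mathbb R}V\ge 1$ and $\dim_{\mathbb R} W\ge 0$. $G$ is a connected Lie group, modelled on a nonzero (finite- or infinite-dimensional) locally convex space, which is locally exponential, i.e. it has a smooth exponential map that restricts to a diffeomorphism from an open neighbourhood of $0$ in the Lie algebra onto an open neighbourhood of $\mathbf 1$. $Z(G)$ is its center, $\mathrm{Aut}_a(G)$ the group of its algebraic automorphisms, and $\mathrm{Aut}(G)$ the group of its Lie group automorphisms. If $\dim G<\infty$, then $\mathrm{Aut}(G)$ carries its usual Lie group structure, for which $\alpha\mapsto d_{\mathbf 1}\alpha$ is an isomorphism onto a closed Lie subgroup of $GL(\mathfrak g)$. A smoothness class for maps $M\to G$ from a finite-dimensional manifold $M$ is one of the following: $C^k$ in the Michal–Bastiani sense ($k=0,1,\dots,\infty$); if $G$ is a Banach Lie group, $C^k$ in the sense of Fréchet differentiability ($k=0,1,\dots,\infty$); if $\dim G<\infty$, locally Hölder $C^{k,\alpha}$ ($k=0,1,\dots$,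 $0\le\alpha\le1$, where $C^{k,0}=C^k$), or locally Sobolev $W^{k,p}$ ($k=1,2,\dots$, $1\le p<\infty$, and $kp>\dim M$, or $k=\dim M$ and $p=1$; the maps are required to be continuous). Let $\mathcal F$ and $\tilde{\mathcal F}$ be smoothness classes for maps $V\to G$ and $W\to G$, respectively. $\mathcal F(V,G)$ is the group of all $\mathcal F$ maps $V\to G$ under pointwise operations; $G$ is identified with the subgroup of constant maps, and $\mathcal F(V,G\setminus\{\mathbf 1\})$ is the set of those $x\in\mathcal F(V,G)$ that omit the value $\mathbf 1$. The notation for $\tilde{\mathcal F}(W,G)$ is analogous. $\mathcal F_c^0(V,G)$ is the normal subgroup of those $x\in \mathcal F(V,G)$ for which there are a compact set $K\subset V$ containing the support of $x$ and a homotopy $H:[0,1]\times V\to G$ relative to $V\setminus K$ with $H(0,\cdot)\equiv\mathbf 1$, $H(1,\cdot)=x$ and $H(t,\cdot)\in\mathcal F(V,G)$ for all $t$. $[x]$ denotes the coset of $\mathcal F_c^0(V,G)$ containing $x$, and $E_w$ the evaluation at $w$. A map $h:\mathcal F(V,G)\to G$ is range decreasing if $h(x)\in x(V)$ for every $x$.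 **Corollary 2.4.** Assume that for every range decreasing group homomorphism $h:\mathcal F(V,G)\to G$ with $h|_{\mathcal F_c^0(V,G)}\not\equiv\mathbf 1$ there exists $v\in V$ such that $h(x)=x(v)$ for all elements $x$ of the cosets $[x_0]$ that contain a non-surjective element $x_0$. Let $f:\mathcal F(V,G)\to\tilde{\mathcal F}(W,G)$ be a group homomorphism. Then the following statements are equivalent. (a) For every $w\in W$, $E_w\circ f|_{\mathcal F_c^0(V,G)}\not\equiv\mathbf 1$ and $E_w\circ f|_G:G\to G$ is surjective. Furthermore, $f(\mathcal F(V,G\setminus\{\mathbf 1\}))\subset\tilde{\mathcal F}(W,G\setminus\{\mathbf 1\})$. (b) There exist maps $\phi:W\to V$, $\gamma:W\to\mathrm{Aut}_a(G)$ and $\psi_W:\mathcal F(V,G)/\mathcal F_c^0(V,G)\times W\to Z(G)$ such that, for every $w\in W$, $\psi_W(\cdot,w)$ is a group homomorphism with $\{[x_0]:x_0(V)\ne G\}\subset\ker\psi_W(\cdot,w)$, and $$f(x)(w)=\gamma(w)\bigl(\psi_W([x],w)\cdot x(\phi(w))\bigr),\qquad x\in\mathcal F(V,G),\ w\in W.$$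 Moreover, for $\phi,\gamma,\psi_W$ as in (b), if $\dim_{\mathbb R}G<\infty$ and $E_w\circ f|_G\in\mathrm{Aut}(G)$ for every $w\in W$, then $\gamma$ takes values in $\mathrm{Aut}(G)$ and $\gamma:W\to\mathrm{Aut}(G)$ is an $\tilde{\mathcal F}$ map. -/

import Mathlib

open Set Filter Topology MeasureTheory
open scoped Manifold ContDiff ENNReal

noncomputable section

namespace MapGroup

universe u

/-! ### Calculus in locally convex spaces -/

section Calculus

variable {E F : Type*} [AddCommGroup E] [Module ℝ E] [TopologicalSpace E]
  [AddCommGroup F] [Module ℝ F] [TopologicalSpace F]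

/-- `f` has directional derivative `d` at `x` in the direction `v`:
the difference quotients `(f (x + t v) - f x) / t` converge to `d` as `t → 0`. -/
def HasDirDeriv (f : E → F) (x v : E) (d : F) : Prop :=
  Tendsto (fun t : ℝ => t⁻¹ • (f (x + t • v) - f x)) (𝓝[≠] 0) (𝓝 d)

/-- `f` is `C^k` in the Michal-Bastiani sense on `s`: the iterated directional derivatives
`D j x (h₁, …, hⱼ)`, `j ≤ k`, exist on the interior of `s` and (extend to) continuous maps
`s × E^j → F`.  It is used for open sets `s`, and for relatively open subsets of a closed
half-space, where the derivatives at the boundary are the continuous extensions.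
The exponent `⊤ : ℕ∞` stands for `C^∞`. -/
def MBContDiffOn (k : ℕ∞) (f : E → F) (s : Set E) : Prop :=
  ∃ D : (j : ℕ) → E → (Fin j → E) → F,
    (∀ x ∈ s, ∀ h, D 0 x h = f x) ∧
    (∀ j : ℕ, (j : ℕ∞) ≤ k →
      ContinuousOn (fun p : E × (Fin j → E) => D j p.1 p.2) (s ×ˢ univ)) ∧
    (∀ j : ℕ, ((j + 1 : ℕ) : ℕ∞) ≤ k → ∀ x ∈ interior s, ∀ (h : Fin j → E) (v : E),
      HasDirDeriv (fun y => D j y h) x v (D (j + 1) x (Fin.snoc (α := fun _ => E) h v)))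

/-- Every Cauchy sequence converges. -/
def IsSeqComplete (E : Type*) [AddCommGroup E] [TopologicalSpace E] : Prop :=
  ∀ a : ℕ → E, (∀ U ∈ 𝓝 (0 : E), ∃ N, ∀ i ≥ N, ∀ j ≥ N, a i - a j ∈ U) →
    ∃ l, Tendsto a atTop (𝓝 l)

/-- The topological vector space `E` is a Banach space (for some norm inducing its topology). -/
def IsBanachable (E : Type u) [AddCommGroup E] [Module ℝ E] [TopologicalSpace E] : Prop :=
  ∃ (B : Type u) (_ : NormedAddCommGroup B) (_ : NormedSpace ℝ B) (_ : CompleteSpace B),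
    Nonempty (E ≃L[ℝ] B)

/-- `C^k` in the sense of Fréchet differentiability, for maps from subsets of `ℝⁿ` into a Banach
space `E`; a norm of `E` is chosen by an isomorphism with a Banach space, and it does
not matter which one is used. -/
def FrechetContDiffOn {n : ℕ} {E : Type u} [AddCommGroup E] [Module ℝ E] [TopologicalSpace E]
    (k : ℕ∞) (f : EuclideanSpace ℝ (Fin n) → E) (s : Set (EuclideanSpace ℝ (Fin n))) : Prop :=
  ∀ (B : Type u) [NormedAddCommGroup B] [NormedSpace ℝ B] [CompleteSpace B] (L : E ≃L[ℝ] B),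
    ContDiffOn ℝ (k : WithTop ℕ∞) (fun y => L (f y)) s

/-- A scalar function on `s ⊆ ℝⁿ` is locally `C^{k,α}`: it is `C^k`, and its `k`-th derivative is
locally Hölder continuous of exponent `α` (no condition if `α = 0`). -/
def HolderOn {n : ℕ} (k : ℕ) (α : ℝ) (f : EuclideanSpace ℝ (Fin n) → ℝ)
    (s : Set (EuclideanSpace ℝ (Fin n))) : Prop :=
  ContDiffOn ℝ k f s ∧ ∀ x ∈ s, ∃ T ∈ 𝓝[s] x, ∃ C : ℝ, ∀ y ∈ T ∩ s, ∀ z ∈ T ∩ s,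
    ‖iteratedFDerivWithin ℝ k f s y - iteratedFDerivWithin ℝ k f s z‖ ≤ C * ‖y - z‖ ^ α

/-- `g` is the weak partial derivative of `f` on the interior of `s`, in the coordinate
directions `i 0, …, i (j - 1)`. -/
def IsWeakPartial {n j : ℕ} (i : Fin j → Fin n) (f g : EuclideanSpace ℝ (Fin n) → ℝ)
    (s : Set (EuclideanSpace ℝ (Fin n))) : Prop :=
  ∀ θ : EuclideanSpace ℝ (Fin n) → ℝ, ContDiff ℝ ∞ θ → HasCompactSupport θ →
    tsupport θ ⊆ interior s →
    ∫ x, f x * iteratedFDeriv ℝ j θ x (fun l => EuclideanSpace.single (i l) (1 : ℝ)) =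
      (-1) ^ j * ∫ x, g x * θ x

/-- A continuous scalar function on `s ⊆ ℝⁿ` is locally of Sobolev class `W^{k,p}`: all its weak
partial derivatives of order at most `k` exist and are `p`-integrable on compact subsets of `s`
(which may touch the boundary points of `s` that belong to `s`). -/
def SobolevOn {n : ℕ} (k : ℕ) (p : ℝ) (f : EuclideanSpace ℝ (Fin n) → ℝ)
    (s : Set (EuclideanSpace ℝ (Fin n))) : Prop :=
  ContinuousOn f s ∧ ∀ j : ℕ, j ≤ k → ∀ i : Fin j → Fin n,
    ∃ g : EuclideanSpace ℝ (Fin n) → ℝ,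
      (∀ K ⊆ s, IsCompact K → MemLp g (ENNReal.ofReal p) (volume.restrict K)) ∧
      IsWeakPartial i f g s

end Calculus

/-! ### Smoothness classes -/

/-- The smoothness classes: `C^k_MB`, Fréchet `C^k` (`k = 0, 1, …, ∞`), locally Hölder `C^{k,α}`,
and locally Sobolev `W^{k,p}`. -/
inductive SmoothnessClass : Type
  | mb (k : ℕ∞)
  | frechet (k : ℕ∞)
  | holder (k : ℕ) (α : ℝ)
  | sobolev (k : ℕ) (p : ℝ)

namespace SmoothnessClass

/-- The conditions under which a smoothness class is considered for maps from an `n`-dimensional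
manifold to a Lie group modelled on `E`: Fréchet classes for Banach Lie groups; Hölder classes with
`0 ≤ α ≤ 1` and Sobolev classes with `k ≥ 1`, `p ≥ 1`, and `kp > n` or `(k, p) = (n, 1)`, for
finite-dimensional Lie groups. -/
def Admissible (𝓕 : SmoothnessClass) (n : ℕ)
    (E : Type u) [AddCommGroup E] [Module ℝ E] [TopologicalSpace E] : Prop :=
  match 𝓕 with
  | mb _ => True
  | frechet _ => IsBanachable E
  | holder _ α => FiniteDimensional ℝ E ∧ 0 ≤ α ∧ α ≤ 1
  | sobolev k p => FiniteDimensional ℝ E ∧ 1 ≤ k ∧ 1 ≤ p ∧ ((n : ℝ) < k * p ∨ (k = n ∧ p = 1))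

/-- The `E`-valued function `f` is of the given class on `s ⊆ ℝⁿ`.  The Hölder and Sobolev classes
are used for finite-dimensional `E`, where the condition is imposed on all coordinate
functions. -/
def On (𝓕 : SmoothnessClass) {n : ℕ}
    {E : Type u} [AddCommGroup E] [Module ℝ E] [TopologicalSpace E]
    (f : EuclideanSpace ℝ (Fin n) → E) (s : Set (EuclideanSpace ℝ (Fin n))) : Prop :=
  match 𝓕 with
  | mb k => MBContDiffOn k f s
  | frechet k => FrechetContDiffOn k f s
  | holder k α => ∀ ℓ : E →L[ℝ] ℝ, HolderOn k α (fun x => ℓ (f x)) s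
  | sobolev k p => ∀ ℓ : E →L[ℝ] ℝ, SobolevOn k p (fun x => ℓ (f x)) s

end SmoothnessClass

/-! ### Lie groups modelled on locally convex spaces -/

section LieGroups

variable (E G : Type*) [AddCommGroup E] [Module ℝ E] [TopologicalSpace E]
  [Group G] [TopologicalSpace G] [ChartedSpace E G]

/-- `G`, with its atlas of charts in the locally convex space `E`, is a (smooth) Lie group:
the changes of charts, the multiplication and the inversion are `C^∞` in the
Michal-Bastiani sense. -/
structure IsMBLieGroup : Prop where
  compatible : ∀ e ∈ atlas E G, ∀ e' ∈ atlas E G,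
    MBContDiffOn ⊤ (fun a : E => e' (e.symm a)) {a | a ∈ e.target ∧ e.symm a ∈ e'.source}
  smooth_mul : ∀ e₁ ∈ atlas E G, ∀ e₂ ∈ atlas E G, ∀ e₃ ∈ atlas E G,
    MBContDiffOn ⊤ (fun q : E × E => e₃ (e₁.symm q.1 * e₂.symm q.2))
      {q | q.1 ∈ e₁.target ∧ q.2 ∈ e₂.target ∧ e₁.symm q.1 * e₂.symm q.2 ∈ e₃.source}
  smooth_inv : ∀ e₁ ∈ atlas E G, ∀ e₂ ∈ atlas E G,
    MBContDiffOn ⊤ (fun a : E => e₂ (e₁.symm a)⁻¹)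
      {a | a ∈ e₁.target ∧ (e₁.symm a)⁻¹ ∈ e₂.source}

variable {E G} in
/-- `c` is a smooth chart of `G` (an element of the maximal atlas): it is smoothly compatible with
every chart of the given atlas. -/
def IsSmoothChart (c : OpenPartialHomeomorph G E) : Prop :=
  ∀ e ∈ atlas E G,
    MBContDiffOn ⊤ (fun a : E => e (c.symm a)) {a | a ∈ c.target ∧ c.symm a ∈ e.source} ∧
    MBContDiffOn ⊤ (fun a : E => c (e.symm a)) {a | a ∈ e.target ∧ e.symm a ∈ c.source}

/-- `G` is locally exponential.  The Lie algebra `T₁G` is identified with `E` by the derivative at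
`1` of the preferred chart at `1`.  There is a smooth exponential map (`t ↦ exp (t a)` is
the one-parameter subgroup with velocity `a` at `t = 0`), and it maps some open neighbourhood of
`0` diffeomorphically onto an open neighbourhood of `1`, i.e. its local inverse is a
smooth chart. -/
def IsLocallyExponential : Prop :=
  ∃ exp : E → G,
    Continuous exp ∧
    (∀ e ∈ atlas E G, MBContDiffOn ⊤ (fun a => e (exp a)) (exp ⁻¹' e.source)) ∧
    (∀ (a : E) (s t : ℝ), exp ((s + t) • a) = exp (s • a) * exp (t • a)) ∧
    (∀ a : E, HasDirDeriv (fun b => chartAt E (1 : G) (exp b)) 0 a a) ∧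
    ∃ c : OpenPartialHomeomorph G E, IsSmoothChart c ∧ (0 : E) ∈ c.target ∧
      ∀ a ∈ c.target, c.symm a = exp a

variable {G} in
/-- A map `G → G` is smooth. -/
def IsSmoothSelfMap (α : G → G) : Prop :=
  Continuous α ∧ ∀ e ∈ atlas E G, ∀ e' ∈ atlas E G,
    MBContDiffOn ⊤ (fun a : E => e' (α (e.symm a))) {a | a ∈ e.target ∧ α (e.symm a) ∈ e'.source}

/-- The set `Aut(G)` of Lie group automorphisms of `G`: the algebraic automorphisms that are smooth
together with their inverses. -/
def LieAut : Type _ :=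
  {α : G ≃* G // IsSmoothSelfMap E (α : G → G) ∧ IsSmoothSelfMap E (α.symm : G → G)}

variable {E G} in
/-- The linear map `A : E → E` is the derivative `d₁α : T₁G → T₁G` at `1` of the
automorphism `α`, where `T₁G` is identified with `E` by the preferred chart at `1`. -/
def IsDerivAtOne (α : G ≃* G) (A : E →L[ℝ] E) : Prop :=
  ∀ v : E, HasDirDeriv
    (fun a => chartAt E (1 : G) (α ((chartAt E (1 : G)).symm a))) (chartAt E (1 : G) 1) v (A v)

end LieGroups

/-! ### Maps of a given class on manifolds with boundary -/

/-- The model with corners describes manifolds without boundary (the range is all of `ℝⁿ`) or with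
boundary (the range is a closed coordinate half-space). -/
def IsBoundaryModel {n : ℕ} {H : Type*} [TopologicalSpace H]
    (I : ModelWithCorners ℝ (EuclideanSpace ℝ (Fin n)) H) : Prop :=
  range I = univ ∨ ∃ i : Fin n, range I = {y | 0 ≤ y i}

section Maps

variable (𝓕 : SmoothnessClass) {n : ℕ} {H : Type*} [TopologicalSpace H]
  (I : ModelWithCorners ℝ (EuclideanSpace ℝ (Fin n)) H)
  {M : Type*} [TopologicalSpace M] [ChartedSpace H M]

/-- The function `f` from the manifold `M` to the vector space `E` is of class `𝓕` near `m`: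
in every smooth chart of `M` around `m`, it is of class `𝓕` on some neighbourhood. -/
def ClassNear {E : Type*} [AddCommGroup E] [Module ℝ E] [TopologicalSpace E]
    (f : M → E) (m : M) : Prop :=
  ∀ e ∈ IsManifold.maximalAtlas I ∞ M, m ∈ e.source →
    ∃ O : Set (EuclideanSpace ℝ (Fin n)), IsOpen O ∧ e.extend I m ∈ O ∧
      𝓕.On (fun y => f ((e.extend I).symm y)) (O ∩ (e.extend I).target)

/-- `x : M → G` is an `𝓕` map into the Lie group `G` modelled on `E`: it is continuous, and
it is of class `𝓕` near every point when it is read in any smooth chart of `G`. -/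
def IsClassMap (E : Type*) [AddCommGroup E] [Module ℝ E] [TopologicalSpace E]
    {G : Type*} [TopologicalSpace G] [ChartedSpace E G] (x : M → G) : Prop :=
  Continuous x ∧ ∀ m : M, ∀ c : OpenPartialHomeomorph G E, IsSmoothChart c → x m ∈ c.source →
    ClassNear 𝓕 I (fun m' => c (x m')) m

/-- `γ : M → Aut(G)` is an `𝓕` map, for a finite-dimensional connected Lie group `G`.
The Lie group structure of `Aut(G)` is the one for which `α ↦ d₁α` is an isomorphism onto a
closed Lie subgroup of `GL(T₁G)`.  Hence `γ` is an `𝓕` map if and only if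
`m ↦ d₁(γ m)` is one, as a map into the vector space of endomorphisms of `T₁G`. -/
def IsClassMapLieAut (E : Type*) [AddCommGroup E] [Module ℝ E] [TopologicalSpace E]
    [IsTopologicalAddGroup E] [ContinuousSMul ℝ E]
    {G : Type*} [Group G] [TopologicalSpace G] [ChartedSpace E G] (γ : M → LieAut E G) : Prop :=
  ∃ A : M → (E →L[ℝ] E), (∀ m, IsDerivAtOne (γ m).1 (A m)) ∧ ∀ m, ClassNear 𝓕 I A m

end Maps

/-! ### Constant maps are of every class -/

section Constants

lemma mbContDiffOn_const {E F : Type*} [AddCommGroup E] [Module ℝ E] [TopologicalSpace E]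
    [AddCommGroup F] [Module ℝ F] [TopologicalSpace F] (k : ℕ∞) (a : F) (s : Set E) :
    MBContDiffOn k (fun _ => a) s := by
  refine ⟨fun j _ _ => if j = 0 then a else 0, ?_, ?_, ?_⟩
  · intro x _ h
    simp
  · intro j _
    exact continuousOn_const
  · intro j _ x _ h v
    simpa [HasDirDeriv] using tendsto_const_nhds

lemma holderOn_const {n : ℕ} (k : ℕ) (α : ℝ) (a : ℝ) (s : Set (EuclideanSpace ℝ (Fin n))) :
    HolderOn k α (fun _ => a) s := by
  refine ⟨contDiffOn_const, fun x _ => ⟨univ, univ_mem, 0, fun y _ z _ => ?_⟩⟩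
  rcases Nat.eq_zero_or_pos k with rfl | hk
  · have : iteratedFDerivWithin ℝ 0 (fun _ : EuclideanSpace ℝ (Fin n) => a) s y =
        iteratedFDerivWithin ℝ 0 (fun _ : EuclideanSpace ℝ (Fin n) => a) s z := by
      ext m
      simp
    simp [this]
  · simp [iteratedFDerivWithin_const_of_ne hk.ne']

lemma isWeakPartial_const {n j : ℕ} (i : Fin j → Fin n) (a : ℝ)
    (s : Set (EuclideanSpace ℝ (Fin n))) :
    IsWeakPartial i (fun _ => a) (fun _ => if j = 0 then a else 0) s := by
  intro θ hθ hc _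
  cases j with
  | zero => simp
  | succ j =>
    set v : Fin (j + 1) → EuclideanSpace ℝ (Fin n) :=
      fun l => EuclideanSpace.single (i l) (1 : ℝ) with hv
    set η : EuclideanSpace ℝ (Fin n) → ℝ := fun x => iteratedFDeriv ℝ j θ x (Fin.tail v) with hη
    have hs : ContDiff ℝ 1 (iteratedFDeriv ℝ j θ) :=
      hθ.iteratedFDeriv_right (m := 1) (i := j) (by exact_mod_cast le_top)
    have hs' : ContDiff ℝ 1 η :=
      (ContinuousMultilinearMap.apply ℝ (fun _ : Fin j => EuclideanSpace ℝ (Fin n)) ℝ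
        (Fin.tail v)).contDiff.comp hs
    have hη_c : HasCompactSupport η :=
      (hc.iteratedFDeriv (𝕜 := ℝ) j).comp_left
        (g := fun T : ContinuousMultilinearMap ℝ (fun _ : Fin j => EuclideanSpace ℝ (Fin n)) ℝ =>
          T (Fin.tail v)) (by simp)
    have hder : ∀ x, iteratedFDeriv ℝ (j + 1) θ x v = fderiv ℝ η x (v 0) := by
      intro x
      rw [iteratedFDeriv_succ_apply_left]
      have := ((ContinuousMultilinearMap.apply ℝ (fun _ : Fin j => EuclideanSpace ℝ (Fin n)) ℝ
        (Fin.tail v)).hasFDerivAt.comp x (hs.differentiable (by simp) x).hasFDerivAt).fderiv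
      have h2 : fderiv ℝ η x = _ := this
      rw [h2]
      rfl
    have hzero : ∫ x, (a * fderiv ℝ η x (v 0)) = 0 := by
      have hd : Continuous fun x => fderiv ℝ η x (v 0) :=
        (hs'.continuous_fderiv (by simp)).clm_apply continuous_const
      have hdc : HasCompactSupport fun x => fderiv ℝ η x (v 0) :=
        (hη_c.fderiv (𝕜 := ℝ)).comp_left
          (g := fun T : EuclideanSpace ℝ (Fin n) →L[ℝ] ℝ => T (v 0)) (by simp)
      have := integral_mul_fderiv_eq_neg_fderiv_mul_of_integrable (μ := volume)
        (f := fun _ : EuclideanSpace ℝ (Fin n) => a) (g := η) (v := v 0)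
        (by simp)
        ((hd.integrable_of_hasCompactSupport hdc).const_mul a)
        ((hs'.continuous.integrable_of_hasCompactSupport hη_c).const_mul a)
        (fun x _ => differentiableAt_const a) (fun x _ => hs'.differentiable (by simp) x)
      simpa using this
    simp only [Nat.succ_ne_zero, if_false, zero_mul, integral_zero, mul_zero]
    simp_rw [hder]
    exact hzero

lemma sobolevOn_const {n : ℕ} (k : ℕ) (p : ℝ) (a : ℝ) (s : Set (EuclideanSpace ℝ (Fin n))) :
    SobolevOn k p (fun _ => a) s := by
  refine ⟨continuousOn_const, fun j _ i => ⟨fun _ => if j = 0 then a else 0, ?_, ?_⟩⟩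
  · intro K _ hK
    have : IsFiniteMeasure (volume.restrict K) := isFiniteMeasure_restrict.2 hK.measure_ne_top
    exact memLp_const _
  · exact isWeakPartial_const i a s

lemma SmoothnessClass.on_const (𝓕 : SmoothnessClass) {n : ℕ} {E : Type*} [AddCommGroup E]
    [Module ℝ E] [TopologicalSpace E] (a : E) (s : Set (EuclideanSpace ℝ (Fin n))) :
    𝓕.On (fun _ => a) s := by
  cases 𝓕 with
  | mb k => exact mbContDiffOn_const k a s
  | frechet k => intro B _ _ _ L; exact contDiffOn_const
  | holder k α => intro ℓ; exact holderOn_const k α _ s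
  | sobolev k p => intro ℓ; exact sobolevOn_const k p _ s

lemma isClassMap_const (𝓕 : SmoothnessClass) {n : ℕ} {H : Type*} [TopologicalSpace H]
    (I : ModelWithCorners ℝ (EuclideanSpace ℝ (Fin n)) H)
    {M : Type*} [TopologicalSpace M] [ChartedSpace H M]
    (E : Type*) [AddCommGroup E] [Module ℝ E] [TopologicalSpace E]
    {G : Type*} [TopologicalSpace G] [ChartedSpace E G] (g : G) :
    IsClassMap 𝓕 I E (fun _ : M => g) :=
  ⟨continuous_const, fun _ _ _ _ _ _ _ =>
    ⟨univ, isOpen_univ, mem_univ _, 𝓕.on_const _ _⟩⟩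

end Constants

/-! ### The mapping group and its subgroup of compactly null-homotopic maps -/

section MappingGroup

variable (𝓕 : SmoothnessClass) {n : ℕ} {H : Type*} [TopologicalSpace H]
  (I : ModelWithCorners ℝ (EuclideanSpace ℝ (Fin n)) H)
  (V : Type*) [TopologicalSpace V] [ChartedSpace H V]
  (E : Type*) [AddCommGroup E] [Module ℝ E] [TopologicalSpace E]
  (G : Type*) [Group G] [TopologicalSpace G] [ChartedSpace E G]

/-- The mapping group `𝓕(V, G)` with pointwise operations, as a subgroup of the group of all
maps `V → G`.  The `𝓕` maps `V → G` are closed under pointwise products and inverses, so that the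
subgroup generated by them consists of the `𝓕` maps only. -/
def mappingGroup : Subgroup (V → G) :=
  Subgroup.closure {x | IsClassMap 𝓕 I E x}

/-- The constant maps, by which `G` is identified with a subgroup of `𝓕(V, G)`. -/
def constHom : G →* mappingGroup 𝓕 I V E G where
  toFun g := ⟨fun _ => g, Subgroup.subset_closure (isClassMap_const 𝓕 I E g)⟩
  map_one' := rfl
  map_mul' _ _ := rfl

variable {V E G} in
lemma continuous_of_mem_mappingGroup [IsTopologicalGroup G] (x : mappingGroup 𝓕 I V E G) :
    Continuous (x : V → G) := by
  have hx := x.2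
  refine Subgroup.closure_induction (p := fun y _ => Continuous y) ?_ ?_ ?_ ?_ hx
  · intro y hy
    exact hy.1
  · exact continuous_const
  · intro y z _ _ hy hz
    exact hy.mul hz
  · intro y _ hy
    exact hy.inv

/-- The subgroup `𝓕_c⁰(V, G)` of the maps `x` for which there are a compact set `K` containing the
support of `x` and a homotopy from the constant map `1` to `x`, relative to the
complement of `K`, through `𝓕` maps. -/
def nullGroup [IsTopologicalGroup G] : Subgroup (mappingGroup 𝓕 I V E G) where
  carrier := {x | ∃ K : Set V, IsCompact K ∧ (∀ v ∉ K, (x : V → G) v = 1) ∧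
    ∃ h : unitInterval × V → G, Continuous h ∧ (∀ v, h (0, v) = 1) ∧
      (∀ v, h (1, v) = (x : V → G) v) ∧ (∀ t, ∀ v ∉ K, h (t, v) = 1) ∧
      ∀ t, (fun v => h (t, v)) ∈ mappingGroup 𝓕 I V E G}
  one_mem' := ⟨∅, isCompact_empty, fun _ _ => rfl, fun _ => 1, continuous_const, fun _ => rfl,
    fun _ => rfl, fun _ _ _ => rfl, fun _ => one_mem _⟩
  mul_mem' := by
    rintro x y ⟨K, hK, hxK, h, hc, h0, h1, hr, hm⟩ ⟨K', hK', hyK, h', hc', h0', h1', hr', hm'⟩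
    refine ⟨K ∪ K', hK.union hK', ?_, fun q => h q * h' q, hc.mul hc', ?_, ?_, ?_, ?_⟩
    · intro v hv
      rw [mem_union, not_or] at hv
      simp [hxK v hv.1, hyK v hv.2]
    · intro v
      simp [h0, h0']
    · intro v
      simp [h1, h1']
    · intro t v hv
      rw [mem_union, not_or] at hv
      simp [hr t v hv.1, hr' t v hv.2]
    · intro t
      exact mul_mem (hm t) (hm' t)
  inv_mem' := by
    rintro x ⟨K, hK, hxK, h, hc, h0, h1, hr, hm⟩
    refine ⟨K, hK, ?_, fun q => (h q)⁻¹, hc.inv, ?_, ?_, ?_, ?_⟩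
    · intro v hv
      simp [hxK v hv]
    · intro v
      simp [h0]
    · intro v
      simp [h1]
    · intro t v hv
      simp [hr t v hv]
    · intro t
      exact inv_mem (hm t)

instance nullGroup_normal [IsTopologicalGroup G] : (nullGroup 𝓕 I V E G).Normal where
  conj_mem := by
    rintro x ⟨K, hK, hxK, h, hc, h0, h1, hr, hm⟩ y
    have hy := continuous_of_mem_mappingGroup 𝓕 I y
    refine ⟨K, hK, ?_, fun q => (y : V → G) q.2 * h q * ((y : V → G) q.2)⁻¹, ?_, ?_, ?_, ?_, ?_⟩
    · intro v hv
      simp [hxK v hv]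
    · exact ((hy.comp continuous_snd).mul hc).mul (hy.comp continuous_snd).inv
    · intro v
      simp [h0]
    · intro v
      simp [h1]
    · intro t v hv
      simp [hr t v hv]
    · intro t
      exact mul_mem (mul_mem y.2 (hm t)) (inv_mem y.2)

end MappingGroup

section Homomorphisms

variable {𝓕 : SmoothnessClass} {n : ℕ} {H : Type*} [TopologicalSpace H]
  {I : ModelWithCorners ℝ (EuclideanSpace ℝ (Fin n)) H}
  {V : Type*} [TopologicalSpace V] [ChartedSpace H V]
  {E : Type*} [AddCommGroup E] [Module ℝ E] [TopologicalSpace E]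
  {G : Type*} [Group G] [TopologicalSpace G] [ChartedSpace E G]

/-- `h : 𝓕(V, G) → G` is range decreasing: `h x ∈ x(V)` for all `x`. -/
def IsRangeDecreasing (h : mappingGroup 𝓕 I V E G →* G) : Prop :=
  ∀ x : mappingGroup 𝓕 I V E G, h x ∈ range (x : V → G)

/-- The restriction of `h : 𝓕(V, G) → G` to `𝓕_c⁰(V, G)` is not constant `1`. -/
def IsNontrivialOnNull [IsTopologicalGroup G] (h : mappingGroup 𝓕 I V E G →* G) : Prop :=
  ∃ y ∈ nullGroup 𝓕 I V E G, h y ≠ 1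

/-- There is a point `v` of `V` such that `h x = x v` for all `x` in the cosets of `𝓕_c⁰(V, G)`
that contain a non-surjective map. -/
def IsEvalOnNonsurjectiveClasses [IsTopologicalGroup G]
    (h : mappingGroup 𝓕 I V E G →* G) : Prop :=
  ∃ v : V, ∀ x₀ : mappingGroup 𝓕 I V E G, range (x₀ : V → G) ≠ univ →
    ∀ x : mappingGroup 𝓕 I V E G,
      (x : mappingGroup 𝓕 I V E G ⧸ nullGroup 𝓕 I V E G) = x₀ → h x = (x : V → G) v

/-- The homomorphism `E_w ∘ f`, where `E_w` is the evaluation at `w`. -/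
def evalComp {W : Type*} (f : mappingGroup 𝓕 I V E G →* (W → G)) (w : W) :
    mappingGroup 𝓕 I V E G →* G :=
  (Pi.evalMonoidHom (fun _ : W => G) w).comp f

/-- For every `w`, `ψ(·, w)` is trivial on the classes of non-surjective maps, and
`f(x)(w) = γ(w)(ψ([x], w) · x(φ(w)))` for all `x` and `w`. -/
def IsWeightedComposition [IsTopologicalGroup G] {W : Type*}
    (f : mappingGroup 𝓕 I V E G →* (W → G)) (φ : W → V) (γ : W → MulAut G)
    (ψ : W → (mappingGroup 𝓕 I V E G ⧸ nullGroup 𝓕 I V E G) →* Subgroup.center G) : Prop :=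
  (∀ w, ∀ x₀ : mappingGroup 𝓕 I V E G, range (x₀ : V → G) ≠ univ → ψ w x₀ = 1) ∧
  ∀ (x : mappingGroup 𝓕 I V E G) (w : W), f x w = γ w ((ψ w x : G) * (x : V → G) (φ w))

end Homomorphisms

end MapGroup

end

noncomputable section

namespace MapGroup

universe u

/-! ### Differential calculus in locally convex spaces: strict differentiability and multilinearity.
-/

section LocallyConvexCalculus

set_option linter.unusedSectionVars false

variable {E F P : Type*} [AddCommGroup E] [Module ℝ E] [TopologicalSpace E]
  [IsTopologicalAddGroup E] [ContinuousSMul ℝ E] [TopologicalSpace P]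
  [AddCommGroup F] [Module ℝ F] [TopologicalSpace F]
  [IsTopologicalAddGroup F] [ContinuousSMul ℝ F]

/-! For (a) ⇒ (b), restricting `E_w ∘ f` to constants gives an automorphism `γ w`: it is onto by
assumption and injective because a constant `g ≠ 1` omits the value `1`. Put `h = (γ w)⁻¹ ∘ E_w ∘
f`, which fixes constants. If `h x` were not a value of `x`, then `x · (h x)⁻¹` would omit `1`
although `h` sends it to `1`; so `h` is range decreasing, and the hypothesis makes it evaluation at
some `v = φ w` on the classes of non-surjective maps. For an arbitrary `x` and `g ≠ 1`, the map `x g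
x⁻¹` omits `1`, so `h x` and `x v` conjugate `g` in the same way. Hence they differ by a central
factor, which is multiplicative in `x` and trivial on the null group (`exists_center_hom_of_eval`,
`exists_isWeightedComposition`).

For (b) ⇒ (a), the formula gives everything about non-surjective maps directly. The point that needs
analysis is that some null-homotopic map is nontrivial at `φ w`. It is `v ↦ exp (θ v • a)` with a
bump function `θ` (`exists_mem_nullGroup_apply_eq_exp`). That this map is of every smoothness class
rests on a calculus of smooth curves: instead of a higher chain rule, one exhibits a family of
functions whose linear span is closed under differentiation.

For the regularity of `γ`, each orbit map `w ↦ γ w g` is the image under `f` of a constant, so it is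
of class `𝓕'`. Since `γ w (exp (t a)) = exp (t • A w a)` with `A w` the derivative at `1`, the
vectors `A w (b i)` on a basis are read off as `δ⁻¹` times the logarithm of `γ w (exp (δ • b i))`,
for one `δ` that works for all `w` near a given point. Such a `δ` comes from Baire's theorem
(`exists_eventually_forall_mem_of_pointwise`). Thus `A` is locally a finite sum of linear images of
`𝓕'` functions (`isClassMapLieAut_of_isClassMap_apply`). -/

lemma HasDirDeriv.unique [T2Space F] {f : E → F} {x v : E} {d d' : F}
    (h : HasDirDeriv f x v d) (h' : HasDirDeriv f x v d') : d = d' :=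
  tendsto_nhds_unique h h'

lemma HasDirDeriv.hasDerivAt_line {f : E → F} {x v : E} {r : ℝ} {d : F}
    (h : HasDirDeriv f (x + r • v) v d) (ℓ : F →L[ℝ] ℝ) :
    HasDerivAt (fun s : ℝ => ℓ (f (x + s • v))) (ℓ d) r := by
  rw [hasDerivAt_iff_tendsto_slope_zero]
  refine ((ℓ.continuous.tendsto d).comp h).congr fun t => ?_
  simp [add_smul, add_assoc]

/-- The mean value theorem: difference quotients lie in every open convex set that contains the
directional derivatives along the segment. -/
lemma slope_mem_of_convex {f : E → F} {d : E → F} {x a : E} {t : ℝ} (ht : t ≠ 0) {C : Set F}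
    (hC : Convex ℝ C) (hCo : IsOpen C)
    (hd : ∀ ξ ∈ Icc (0 : ℝ) 1, HasDirDeriv f (x + (ξ * t) • a) a (d (x + (ξ * t) • a)) ∧
      d (x + (ξ * t) • a) ∈ C) :
    t⁻¹ • (f (x + t • a) - f x) ∈ C := by
  by_contra hq
  -- A functional separating the quotient from `C` reduces the claim to the scalar mean value
  -- theorem.
  obtain ⟨ℓ, hℓ⟩ := geometric_hahn_banach_open_point hC hCo hq
  have hder : ∀ ξ ∈ Icc (0 : ℝ) 1, HasDerivAt (fun ξ : ℝ => ℓ (f (x + (ξ * t) • a)))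
      (ℓ (d (x + (ξ * t) • a)) * t) ξ := by
    intro ξ hξ
    have h1 := HasDirDeriv.hasDerivAt_line (hd ξ hξ).1 ℓ
    have h2 : HasDerivAt (fun ξ : ℝ => ξ * t) t ξ := by
      simpa using (hasDerivAt_id ξ).mul_const t
    exact HasDerivAt.comp ξ h1 h2
  obtain ⟨c, hc, hceq⟩ := exists_hasDerivAt_eq_slope _ _ (zero_lt_one' ℝ)
    (fun ξ hξ => (hder ξ hξ).continuousAt.continuousWithinAt)
    (fun ξ hξ => hder ξ (Ioo_subset_Icc_self hξ))
  have h1 := hℓ _ (hd c (Ioo_subset_Icc_self hc)).2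
  have h2 : ℓ (t⁻¹ • (f (x + t • a) - f x)) = ℓ (d (x + (c * t) • a)) := by
    simp only [one_mul, zero_mul, zero_smul, add_zero, sub_zero, div_one] at hceq
    rw [map_smul, map_sub, ← hceq, smul_eq_mul]
    field_simp
  exact absurd h1 (by rw [h2]; exact lt_irrefl _)

/-- Continuously differentiable maps are strictly differentiable, also with parameters. -/
lemma tendsto_slope_of_hasDirDeriv [LocallyConvexSpace ℝ F] {f : P → E → F} {d : P → E → E → F}
    {s : Set E} (hs : IsOpen s) (hd : ∀ p, ∀ x ∈ s, ∀ v, HasDirDeriv (f p) x v (d p x v))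
    (hc : ContinuousOn (fun q : P × E × E => d q.1 q.2.1 q.2.2) (univ ×ˢ s ×ˢ univ))
    {p : ℝ → P} {x a : ℝ → E} {p₀ : P} {x₀ a₀ : E} (hx₀ : x₀ ∈ s)
    (hp : Tendsto p (𝓝[≠] 0) (𝓝 p₀)) (hx : Tendsto x (𝓝[≠] 0) (𝓝 x₀))
    (ha : Tendsto a (𝓝[≠] 0) (𝓝 a₀)) :
    Tendsto (fun t : ℝ => t⁻¹ • (f (p t) (x t + t • a t) - f (p t) (x t))) (𝓝[≠] 0)
      (𝓝 (d p₀ x₀ a₀)) := by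
  rw [(LocallyConvexSpace.convex_basis (𝕜 := ℝ) (d p₀ x₀ a₀)).tendsto_right_iff]
  rintro C' ⟨hC'n, hC'⟩
  set C := interior C' with hCdef
  have hC : Convex ℝ C := hC'.interior
  have hCo : IsOpen C := isOpen_interior
  have hdC : d p₀ x₀ a₀ ∈ C := mem_interior_iff_mem_nhds.2 hC'n
  -- The product with the principal filter of `[0, 1]` encodes uniformity in the position `ξ` on the
  -- segment.
  have hξ : Tendsto (fun q : ℝ × ℝ => q.2 * q.1) (𝓝[≠] 0 ×ˢ 𝓟 (Icc (0 : ℝ) 1)) (𝓝 0) := by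
    have h1 : Tendsto (fun q : ℝ × ℝ => |q.1|) (𝓝[≠] 0 ×ˢ 𝓟 (Icc (0 : ℝ) 1)) (𝓝 0) := by
      have : Tendsto (fun t : ℝ => |t|) (𝓝[≠] 0) (𝓝 0) := by
        simpa using (continuous_abs.tendsto (0 : ℝ)).mono_left nhdsWithin_le_nhds
      exact this.comp tendsto_fst
    refine squeeze_zero_norm' ?_ h1
    rw [Filter.eventually_prod_principal_iff]
    refine Eventually.of_forall fun t ξ hξ => ?_
    rw [Real.norm_eq_abs, abs_mul, abs_of_nonneg hξ.1]
    exact mul_le_of_le_one_left (abs_nonneg _) hξ.2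
  have hxx : Tendsto (fun q : ℝ × ℝ => x q.1 + (q.2 * q.1) • a q.1)
      (𝓝[≠] 0 ×ˢ 𝓟 (Icc (0 : ℝ) 1)) (𝓝 x₀) := by
    simpa using (hx.comp tendsto_fst).add (hξ.smul (ha.comp tendsto_fst))
  have hall : Tendsto (fun q : ℝ × ℝ => (p q.1, x q.1 + (q.2 * q.1) • a q.1, a q.1))
      (𝓝[≠] 0 ×ˢ 𝓟 (Icc (0 : ℝ) 1)) (𝓝 (p₀, x₀, a₀)) :=
    (hp.comp tendsto_fst).prodMk_nhds (hxx.prodMk_nhds (ha.comp tendsto_fst))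
  have hopen : IsOpen ((univ : Set P) ×ˢ s ×ˢ (univ : Set E)) :=
    isOpen_univ.prod (hs.prod isOpen_univ)
  have hcat : ContinuousAt (fun q : P × E × E => d q.1 q.2.1 q.2.2) (p₀, x₀, a₀) :=
    hc.continuousAt (hopen.mem_nhds ⟨mem_univ _, hx₀, mem_univ _⟩)
  have ev1 : ∀ᶠ q : ℝ × ℝ in 𝓝[≠] 0 ×ˢ 𝓟 (Icc (0 : ℝ) 1),
      x q.1 + (q.2 * q.1) • a q.1 ∈ s := hxx (hs.mem_nhds hx₀)
  have ev2 : ∀ᶠ q : ℝ × ℝ in 𝓝[≠] 0 ×ˢ 𝓟 (Icc (0 : ℝ) 1),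
      d (p q.1) (x q.1 + (q.2 * q.1) • a q.1) (a q.1) ∈ C :=
    (hcat.tendsto.comp hall) (hCo.mem_nhds hdC)
  have ev := ev1.and ev2
  rw [Filter.eventually_prod_principal_iff] at ev
  filter_upwards [ev, self_mem_nhdsWithin] with t ht ht0
  exact interior_subset (slope_mem_of_convex (d := fun y => d (p t) y (a t)) ht0 hC hCo
    fun ξ hξ => ⟨hd _ _ (ht ξ hξ).1 _, (ht ξ hξ).2⟩)

lemma ContinuousOn.dirDeriv_param {D : E → E → F} {s : Set E}
    (hc : ContinuousOn (fun q : E × E => D q.1 q.2) (s ×ˢ univ)) :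
    ContinuousOn (fun q : Unit × E × E => D q.2.1 q.2.2) (univ ×ˢ s ×ˢ univ) :=
  hc.comp continuous_snd.continuousOn fun _ hq => hq.2

lemma tendsto_slope_of_hasDirDeriv' [LocallyConvexSpace ℝ F] {f : E → F} {d : E → E → F}
    {s : Set E} (hs : IsOpen s) (hd : ∀ x ∈ s, ∀ v, HasDirDeriv f x v (d x v))
    (hc : ContinuousOn (fun q : E × E => d q.1 q.2) (s ×ˢ univ))
    {x a : ℝ → E} {x₀ a₀ : E} (hx₀ : x₀ ∈ s) (hx : Tendsto x (𝓝[≠] 0) (𝓝 x₀))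
    (ha : Tendsto a (𝓝[≠] 0) (𝓝 a₀)) :
    Tendsto (fun t : ℝ => t⁻¹ • (f (x t + t • a t) - f (x t))) (𝓝[≠] 0) (𝓝 (d x₀ a₀)) :=
  tendsto_slope_of_hasDirDeriv (P := Unit) (f := fun _ => f) (d := fun _ => d) hs
    (fun _ => hd) (ContinuousOn.dirDeriv_param hc) hx₀ tendsto_const_nhds hx ha (p := fun _ => ())

lemma tendsto_add_smul_nhdsNE (x v : E) :
    Tendsto (fun t : ℝ => x + t • v) (𝓝[≠] 0) (𝓝 x) := by
  have h : Continuous fun t : ℝ => x + t • v := by fun_prop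
  simpa using (h.tendsto 0).mono_left nhdsWithin_le_nhds

lemma dirDeriv_add [LocallyConvexSpace ℝ F] [T2Space F] {f : E → F} {d : E → E → F}
    {s : Set E} (hs : IsOpen s) (hd : ∀ x ∈ s, ∀ v, HasDirDeriv f x v (d x v))
    (hc : ContinuousOn (fun q : E × E => d q.1 q.2) (s ×ˢ univ)) {x : E} (hx : x ∈ s) (u v : E) :
    d x (u + v) = d x u + d x v := by
  refine HasDirDeriv.unique (hd x hx (u + v)) ?_
  -- The increment along `t (u + v)` is split at the moving point `x + t u`; strict
  -- differentiability handles the second leg.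
  have h1 := tendsto_slope_of_hasDirDeriv' hs hd hc hx (tendsto_add_smul_nhdsNE x u)
    (tendsto_const_nhds (x := v))
  have h2 := hd x hx u
  refine (h2.add h1).congr fun t => ?_
  rw [← smul_add, smul_add t u v]
  congr 1
  rw [← add_assoc]
  abel

lemma dirDeriv_smul [LocallyConvexSpace ℝ F] [T2Space F] {f : E → F} {d : E → E → F}
    {s : Set E} (hs : IsOpen s) (hd : ∀ x ∈ s, ∀ v, HasDirDeriv f x v (d x v))
    (hc : ContinuousOn (fun q : E × E => d q.1 q.2) (s ×ˢ univ)) {x : E} (hx : x ∈ s) (c : ℝ)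
    (v : E) : d x (c • v) = c • d x v := by
  have hcont : Continuous (d x) := by
    rw [← continuousOn_univ]
    exact hc.comp (continuousOn_const.prodMk continuousOn_id) fun v _ => ⟨hx, mem_univ _⟩
  exact map_real_smul (AddMonoidHom.mk' (d x) (dirDeriv_add hs hd hc hx)) hcont c v

/-- The iterated directional derivatives are multilinear. -/
lemma exists_multilinearMap_of_iterated_dirDeriv [LocallyConvexSpace ℝ F] [T2Space F] {s : Set E}
    (hs : IsOpen s) {D : (j : ℕ) → E → (Fin j → E) → F}
    (hc : ∀ j, ContinuousOn (fun p : E × (Fin j → E) => D j p.1 p.2) (s ×ˢ univ))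
    (hd : ∀ j, ∀ x ∈ s, ∀ (h : Fin j → E) (v : E),
      HasDirDeriv (fun y => D j y h) x v (D (j + 1) x (Fin.snoc (α := fun _ => E) h v)))
    (j : ℕ) {x : E} (hx : x ∈ s) :
    ∃ M : MultilinearMap ℝ (fun _ : Fin j => E) F, ∀ h, M h = D j x h := by
  have hadd : ∀ j : ℕ, ∀ x ∈ s, ∀ (l : Fin j) (h : Fin j → E) (u v : E),
      D j x (Function.update h l (u + v)) =
        D j x (Function.update h l u) + D j x (Function.update h l v) := by
    intro j
    induction j with
    | zero => intro _ _ l; exact l.elim0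
    | succ j ih =>
      intro x hx l h u v
      obtain ⟨h', w, rfl⟩ : ∃ (h' : Fin j → E) (w : E), h = Fin.snoc (α := fun _ => E) h' w :=
        ⟨Fin.init h, h (Fin.last j), (Fin.snoc_init_self h).symm⟩
      induction l using Fin.lastCases with
      | last =>
        simp only [Fin.update_snoc_last]
        refine dirDeriv_add (f := fun y => D j y h')
          (d := fun y v => D (j + 1) y (Fin.snoc (α := fun _ => E) h' v)) hs
          (fun x hx v => hd j x hx h' v) ?_ hx u v
        refine (hc (j + 1)).comp (f := fun q : E × E => (q.1, Fin.snoc (α := fun _ => E) h' q.2))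
          ?_ (fun q hq => ⟨hq.1, mem_univ _⟩)
        exact Continuous.continuousOn (by fun_prop)
      | cast l =>
        simp only [← Fin.snoc_update]
        -- In the last slot, additivity is that of a directional derivative; in the earlier slots it
        -- is inherited from order `j` by passing to the limit.
        refine HasDirDeriv.unique (hd j x hx _ w) ?_
        refine ((hd j x hx (Function.update h' l u) w).add
          (hd j x hx (Function.update h' l v) w)).congr' ?_
        have : ∀ᶠ t : ℝ in 𝓝[≠] 0, x + t • w ∈ s :=
          tendsto_add_smul_nhdsNE x w (hs.mem_nhds hx)
        filter_upwards [this] with t ht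
        rw [ih _ ht, ih _ hx, ← smul_add]
        congr 1
        abel
  have hcont : ∀ x ∈ s, Continuous (D j x) := fun x hx => by
    rw [← continuousOn_univ]
    exact (hc j).comp (continuousOn_const.prodMk continuousOn_id) fun v _ => ⟨hx, mem_univ _⟩
  refine ⟨{ toFun := D j x, map_update_add' := ?_, map_update_smul' := ?_ }, fun _ => rfl⟩
  · intro inst h l u v
    obtain rfl := Subsingleton.elim inst (instDecidableEqFin j)
    exact hadd j x hx l h u v
  · intro inst h l c v
    obtain rfl := Subsingleton.elim inst (instDecidableEqFin j)
    exact map_real_smul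
      (AddMonoidHom.mk' (fun u => D j x (Function.update h l u)) (hadd j x hx l h))
      ((hcont x hx).comp (by fun_prop)) c v

end LocallyConvexCalculus

/-! ### Smooth curves and their composition with smooth maps. -/

section Curves

set_option linter.unusedSectionVars false

variable {E F : Type*} [AddCommGroup E] [Module ℝ E] [TopologicalSpace E]
  [IsTopologicalAddGroup E] [ContinuousSMul ℝ E]
  [AddCommGroup F] [Module ℝ F] [TopologicalSpace F]
  [IsTopologicalAddGroup F] [ContinuousSMul ℝ F]

lemma HasDirDeriv.add {f g : E → F} {x v : E} {d d' : F} (hf : HasDirDeriv f x v d)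
    (hg : HasDirDeriv g x v d') : HasDirDeriv (fun y => f y + g y) x v (d + d') := by
  refine (Tendsto.add hf hg).congr fun t => ?_
  rw [← smul_add, add_sub_add_comm]

lemma HasDirDeriv.const_smul {f : E → F} {x v : E} {d : F} (c : ℝ) (hf : HasDirDeriv f x v d) :
    HasDirDeriv (fun y => c • f y) x v (c • d) := by
  refine (Tendsto.const_smul hf c).congr fun t => ?_
  rw [← smul_sub, smul_comm]

lemma HasDirDeriv.zero (x v : E) : HasDirDeriv (fun _ : E => (0 : F)) x v 0 := by
  simpa [HasDirDeriv] using tendsto_const_nhds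

lemma HasDirDeriv.sum {ι : Type*} (S : Finset ι) {f : ι → E → F} {x v : E} {d : ι → F}
    (hf : ∀ i ∈ S, HasDirDeriv (f i) x v (d i)) :
    HasDirDeriv (fun y => ∑ i ∈ S, f i y) x v (∑ i ∈ S, d i) := by
  classical
  induction S using Finset.induction_on with
  | empty => simpa using HasDirDeriv.zero x v
  | insert i S hi ih =>
    simp only [Finset.sum_insert hi]
    exact (hf i (Finset.mem_insert_self i S)).add
      (ih fun k hk => hf k (Finset.mem_insert_of_mem hk))

lemma HasDirDeriv.smul_dir {f : E → F} {x v : E} {d : F} (hf : HasDirDeriv f x v d) (c : ℝ) :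
    HasDirDeriv f x (c • v) (c • d) := by
  rcases eq_or_ne c 0 with rfl | hc
  · simpa [HasDirDeriv] using (tendsto_const_nhds : Tendsto (fun _ : ℝ => (0 : F)) (𝓝[≠] 0) (𝓝 0))
  have h1 : Tendsto (fun t : ℝ => t * c) (𝓝[≠] 0) (𝓝[≠] 0) := by
    refine tendsto_nhdsWithin_iff.2 ⟨?_, ?_⟩
    · have : Continuous fun t : ℝ => t * c := by fun_prop
      simpa using (this.tendsto 0).mono_left nhdsWithin_le_nhds
    · filter_upwards [self_mem_nhdsWithin] with t ht
      exact mul_ne_zero ht hc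
  refine ((Tendsto.comp hf h1).const_smul c).congr fun t => ?_
  simp only [Function.comp, smul_smul, mul_inv]
  congr 1
  field_simp

lemma HasDirDeriv.tendsto {f : E → F} {x v : E} {d : F} (hf : HasDirDeriv f x v d) :
    Tendsto (fun t : ℝ => f (x + t • v)) (𝓝[≠] 0) (𝓝 (f x)) := by
  have h1 : Tendsto (fun t : ℝ => t) (𝓝[≠] 0) (𝓝 0) := nhdsWithin_le_nhds
  have h2 := (h1.smul hf).const_add (f x)
  rw [zero_smul, add_zero] at h2
  refine h2.congr' ?_
  filter_upwards [self_mem_nhdsWithin] with t ht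
  rw [smul_smul, mul_inv_cancel₀ ht, one_smul]
  abel

lemma HasDirDeriv.congr' {f g : E → F} {x v : E} {d : F} (hf : HasDirDeriv f x v d) {s : Set E}
    (hs : s ∈ 𝓝 x) (h : EqOn f g s) : HasDirDeriv g x v d := by
  refine Tendsto.congr' ?_ hf
  filter_upwards [tendsto_add_smul_nhdsNE x v hs] with t ht
  rw [h ht, h (mem_of_mem_nhds hs)]

/-- `σ 0` is a smooth curve on `R`, with iterated derivatives `σ i`. -/
def IsSmoothCurveOn (σ : ℕ → ℝ → F) (R : Set ℝ) : Prop :=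
  ∀ i, ContinuousOn (σ i) R ∧ ∀ r ∈ R, HasDirDeriv (σ i) r 1 (σ (i + 1) r)

/-- Differentiation extends linearly from `S` to its span and maps the span into itself, so a choice
of derivative can be iterated. This replaces explicit formulas for higher derivatives. -/
lemma exists_isSmoothCurveOn_of_span {S : Set (ℝ → F)} {R : Set ℝ}
    (hc : ∀ u ∈ S, ContinuousOn u R)
    (hd : ∀ u ∈ S, ∃ u' ∈ Submodule.span ℝ S, ∀ r ∈ R, HasDirDeriv u r 1 (u' r))
    {u : ℝ → F} (hu : u ∈ Submodule.span ℝ S) :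
    ∃ σ : ℕ → ℝ → F, IsSmoothCurveOn σ R ∧ σ 0 = u := by
  have hc' : ∀ u ∈ Submodule.span ℝ S, ContinuousOn u R := by
    intro u hu
    induction hu using Submodule.span_induction with
    | mem u hu => exact hc u hu
    | zero => exact continuousOn_const
    | add u v _ _ hu hv => exact hu.add hv
    | smul c u _ hu => exact hu.const_smul c
  have hd' : ∀ u ∈ Submodule.span ℝ S, ∃ u' ∈ Submodule.span ℝ S,
      ∀ r ∈ R, HasDirDeriv u r 1 (u' r) := by
    intro u hu
    induction hu using Submodule.span_induction with
    | mem u hu => exact hd u hu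
    | zero => exact ⟨0, zero_mem _, fun r _ => HasDirDeriv.zero r 1⟩
    | add u v _ _ hu hv =>
      obtain ⟨u', hu', hu⟩ := hu
      obtain ⟨v', hv', hv⟩ := hv
      exact ⟨u' + v', add_mem hu' hv', fun r hr => (hu r hr).add (hv r hr)⟩
    | smul c u _ hu =>
      obtain ⟨u', hu', hu⟩ := hu
      exact ⟨c • u', Submodule.smul_mem _ c hu', fun r hr => (hu r hr).const_smul c⟩
  choose! δ hδ hδd using hd'
  have hmem : ∀ i, δ^[i] u ∈ Submodule.span ℝ S := by
    intro i
    induction i with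
    | zero => exact hu
    | succ i ih => rw [Function.iterate_succ_apply']; exact hδ _ ih
  refine ⟨fun i => δ^[i] u, fun i => ⟨hc' _ (hmem i), fun r hr => ?_⟩, rfl⟩
  simp only [Function.iterate_succ_apply']
  exact hδd _ (hmem i) r hr

/-- The Leibniz rule, obtained by moving the arguments from time `r` to time `r + t` one at a time;
the induction runs over the set of arguments already moved. -/
lemma MultilinearMap.tendsto_slope {j : ℕ} (M : MultilinearMap ℝ (fun _ : Fin j => E) F)
    (hM : Continuous M) {h : Fin j → ℝ → E} {h' : Fin j → E} {r : ℝ}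
    (hh : ∀ l, HasDirDeriv (h l) r 1 (h' l)) :
    HasDirDeriv (fun r => M fun l => h l r) r 1
      (∑ l, M (Function.update (fun l => h l r) l (h' l))) := by
  have key : ∀ S : Finset (Fin j), Tendsto (fun t : ℝ => t⁻¹ •
      (M (S.piecewise (fun l => h l (r + t • 1)) (fun l => h l r)) - M fun l => h l r)) (𝓝[≠] 0)
      (𝓝 (∑ l ∈ S, M (Function.update (fun l => h l r) l (h' l)))) := by
    intro S
    induction S using Finset.induction_on with
    | empty => simpa using tendsto_const_nhds
    | insert l S hl ih =>
      rw [Finset.sum_insert hl]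
      have hpw : Tendsto (fun t : ℝ => S.piecewise (fun l => h l (r + t • 1)) (fun l => h l r))
          (𝓝[≠] 0) (𝓝 fun l => h l r) := by
        rw [tendsto_pi_nhds]
        intro i
        by_cases hi : i ∈ S
        · simpa [hi] using (hh i).tendsto
        · simpa [hi] using tendsto_const_nhds
      have h1 : Tendsto (fun t : ℝ => M (Function.update
          (S.piecewise (fun l => h l (r + t • 1)) (fun l => h l r)) l
          (t⁻¹ • (h l (r + t • 1) - h l r)))) (𝓝[≠] 0)
          (𝓝 (M (Function.update (fun l => h l r) l (h' l)))) :=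
        (hM.tendsto _).comp (hpw.update l (hh l))
      refine (h1.add ih).congr fun t => ?_
      rw [M.map_update_smul, M.map_update_sub, Finset.piecewise_insert]
      have h2 : Function.update (S.piecewise (fun l => h l (r + t • 1)) (fun l => h l r)) l (h l r)
          = S.piecewise (fun l => h l (r + t • 1)) (fun l => h l r) := by
        rw [Function.update_eq_self_iff]
        simp [hl]
      rw [h2, ← smul_add]
      congr 1
      abel
  have := key Finset.univ
  simpa [HasDirDeriv] using this

variable [LocallyConvexSpace ℝ F] [T2Space F] {s : Set E} {D : (j : ℕ) → E → (Fin j → E) → F}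

/-- Chain and Leibniz rule combined: first the base point moves while the vectors are already at
time `r + t`, then the vectors move at the fixed base point `η r`. The first move is why strict
differentiability is needed with parameters. -/
lemma hasDirDeriv_iterated_comp (hs : IsOpen s)
    (hc : ∀ j, ContinuousOn (fun p : E × (Fin j → E) => D j p.1 p.2) (s ×ˢ univ))
    (hd : ∀ j, ∀ x ∈ s, ∀ (h : Fin j → E) (v : E),
      HasDirDeriv (fun y => D j y h) x v (D (j + 1) x (Fin.snoc (α := fun _ => E) h v)))
    {η : ℝ → E} {η' : E} {r : ℝ} (hr : η r ∈ s) (hη : HasDirDeriv η r 1 η') {j : ℕ}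
    {h : Fin j → ℝ → E} {h' : Fin j → E} (hh : ∀ l, HasDirDeriv (h l) r 1 (h' l)) :
    HasDirDeriv (fun r => D j (η r) (fun l => h l r)) r 1
      (D (j + 1) (η r) (Fin.snoc (α := fun _ => E) (fun l => h l r) η') +
        ∑ l, D j (η r) (Function.update (fun l => h l r) l (h' l))) := by
  obtain ⟨M, hM⟩ := exists_multilinearMap_of_iterated_dirDeriv hs hc hd j hr
  have hMc : Continuous M := by
    have : (M : (Fin j → E) → F) = D j (η r) := funext hM
    rw [this, ← continuousOn_univ]
    exact (hc j).comp (continuousOn_const.prodMk continuousOn_id) fun v _ => ⟨hr, mem_univ _⟩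
  have h1 := MultilinearMap.tendsto_slope M hMc hh
  simp only [hM] at h1
  have hp : Tendsto (fun (t : ℝ) l => h l (r + t • 1)) (𝓝[≠] 0) (𝓝 fun l => h l r) :=
    tendsto_pi_nhds.2 fun l => (hh l).tendsto
  have h2 := tendsto_slope_of_hasDirDeriv (P := Fin j → E) (f := fun p y => D j y p)
    (d := fun p y v => D (j + 1) y (Fin.snoc (α := fun _ => E) p v)) hs
    (fun p x hx v => hd j x hx p v) ?_ hr hp (tendsto_const_nhds (x := η r)) hη
  · refine (h2.add h1).congr' ?_
    filter_upwards [self_mem_nhdsWithin] with t ht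
    rw [← smul_add, smul_smul, mul_inv_cancel₀ ht, one_smul, add_sub_cancel]
    congr 1
    abel
  · refine (hc (j + 1)).comp (f := fun q : (Fin j → E) × E × E =>
      (q.2.1, Fin.snoc (α := fun _ => E) q.1 q.2.2)) ?_ (fun q hq => ⟨hq.2.1, mem_univ _⟩)
    exact Continuous.continuousOn (by fun_prop)

/-- The composition of a smooth map with a smooth curve is a smooth curve. -/
lemma MBContDiffOn.comp_curve {f : E → F} (hs : IsOpen s) (hf : MBContDiffOn ⊤ f s)
    {η : ℕ → ℝ → E} {R : Set ℝ} (hη : IsSmoothCurveOn η R) (hR : MapsTo (η 0) R s) :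
    ∃ σ : ℕ → ℝ → F, IsSmoothCurveOn σ R ∧ ∀ r ∈ R, σ 0 r = f (η 0 r) := by
  obtain ⟨D, h0, hc, hd⟩ := hf
  replace hc := fun j => hc j le_top
  replace hd := fun j => hd j le_top
  rw [hs.interior_eq] at hd
  -- These are the terms of the Faà di Bruno formula. Differentiating one either appends the
  -- velocity `η 1` (base point) or raises one index `i l` by one (vector slot), so the span is
  -- closed under differentiation.
  set S : Set (ℝ → F) :=
    range fun q : (Σ j : ℕ, Fin j → ℕ) => fun r => D q.1 (η 0 r) fun l => η (q.2 l) r with hS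
  have hSm : ∀ (j : ℕ) (i : Fin j → ℕ), (fun r => D j (η 0 r) fun l => η (i l) r) ∈ S :=
    fun j i => ⟨⟨j, i⟩, rfl⟩
  have hSc : ∀ u ∈ S, ContinuousOn u R := by
    rintro _ ⟨⟨j, i⟩, rfl⟩
    refine (hc j).comp (f := fun r => (η 0 r, fun l => η (i l) r)) ?_
      (fun r hr => ⟨hR hr, mem_univ _⟩)
    exact (hη 0).1.prodMk (continuousOn_pi.2 fun l => (hη _).1)
  have hSd : ∀ u ∈ S, ∃ u' ∈ Submodule.span ℝ S, ∀ r ∈ R, HasDirDeriv u r 1 (u' r) := by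
    rintro _ ⟨⟨j, i⟩, rfl⟩
    refine ⟨(fun r => D (j + 1) (η 0 r) fun l => η (Fin.snoc (α := fun _ => ℕ) i 1 l) r) +
      ∑ l, fun r => D j (η 0 r) fun k => η (Function.update i l (i l + 1) k) r,
      add_mem (Submodule.subset_span (hSm _ _))
        (sum_mem fun l _ => Submodule.subset_span (hSm _ _)), fun r hr => ?_⟩
    have := hasDirDeriv_iterated_comp hs hc hd (hR hr) ((hη 0).2 r hr) (j := j)
      (h := fun l => η (i l)) (fun l => (hη (i l)).2 r hr)
    convert this using 1
    simp only [Pi.add_apply, Finset.sum_apply]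
    congr 1
    · congr 1
      ext l
      induction l using Fin.lastCases with
      | last => simp
      | cast l => simp
    · refine Finset.sum_congr rfl fun l _ => ?_
      congr 1
      ext k
      rcases eq_or_ne k l with rfl | hk
      · simp
      · simp [hk]
  obtain ⟨σ, hσ, hσ0⟩ := exists_isSmoothCurveOn_of_span hSc hSd
    (Submodule.subset_span (hSm 0 Fin.elim0))
  refine ⟨σ, hσ, fun r hr => ?_⟩
  rw [hσ0]
  exact h0 _ (hR hr) _

end Curves

/-! ### Smooth functions belong to every smoothness class. -/

section ClassesOfComposites

set_option linter.unusedSectionVars false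

variable {n : ℕ} {s : Set (EuclideanSpace ℝ (Fin n))}

/-- The `k`-th derivative is `C^1`, hence locally Lipschitz on a convex set. On a ball of radius
`1/2` distances are at most `1`, so `‖y - z‖ ≤ ‖y - z‖ ^ α`. -/
lemma holderOn_of_contDiffOn {k : ℕ} {α : ℝ} (hα : 0 ≤ α) (hα' : α ≤ 1)
    {f : EuclideanSpace ℝ (Fin n) → ℝ} (hs : UniqueDiffOn ℝ s) (hconv : Convex ℝ s)
    (hf : ContDiffOn ℝ ∞ f s) : HolderOn k α f s := by
  refine ⟨hf.of_le (by exact_mod_cast le_top), fun x hx => ?_⟩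
  have h1 : ContDiffWithinAt ℝ 1 (iteratedFDerivWithin ℝ k f s) s x :=
    (hf x hx).iteratedFDerivWithin_right hs (m := 1) (by exact_mod_cast le_top) hx
  obtain ⟨K, t, ht, hK⟩ := h1.exists_lipschitzOnWith hconv
  refine ⟨t ∩ Metric.ball x (1 / 2), inter_mem ht
    (mem_nhdsWithin_of_mem_nhds (Metric.ball_mem_nhds x (by norm_num))), K, ?_⟩
  rintro y ⟨⟨hy, hy'⟩, -⟩ z ⟨⟨hz, hz'⟩, -⟩
  have h2 := hK.dist_le_mul y hy z hz
  rw [dist_eq_norm, dist_eq_norm] at h2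
  refine h2.trans (mul_le_mul_of_nonneg_left ?_ K.2)
  have h3 : ‖y - z‖ ≤ 1 := by
    rw [← dist_eq_norm]
    rw [Metric.mem_ball] at hy' hz'
    linarith [dist_triangle_right y z x]
  simpa using Real.rpow_le_rpow_of_exponent_ge' (norm_nonneg _) h3 hα hα'

lemma integrable_mul_of_tsupport_subset {f g : EuclideanSpace ℝ (Fin n) → ℝ}
    (hf : ContinuousOn f s) (hg : Continuous g) (hgc : HasCompactSupport g)
    (hgs : tsupport g ⊆ interior s) : Integrable (fun x => f x * g x) := by
  refine Continuous.integrable_of_hasCompactSupport ?_ hgc.mul_left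
  refine continuous_of_tsupport fun x hx => ?_
  have hx' : x ∈ interior s := hgs (tsupport_mul_subset_right hx)
  exact (hf.continuousAt (mem_interior_iff_mem_nhds.1 hx')).mul hg.continuousAt

/-- Integration by parts moves one derivative at a time from the test function to `f`, starting with
the outermost direction `i 0`. -/
lemma exists_isWeakPartial {j : ℕ} (i : Fin j → Fin n) {f : EuclideanSpace ℝ (Fin n) → ℝ}
    (hs : UniqueDiffOn ℝ s) (hf : ContDiffOn ℝ ∞ f s) :
    ∃ g, ContDiffOn ℝ ∞ g s ∧ IsWeakPartial i f g s := by
  induction j generalizing f with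
  | zero =>
    refine ⟨f, hf, fun θ _ _ _ => ?_⟩
    simp
  | succ j ih =>
    set e : EuclideanSpace ℝ (Fin n) := EuclideanSpace.single (i 0) (1 : ℝ) with he
    have hf' : ContDiffOn ℝ ∞ (fun x => fderivWithin ℝ f s x e) s :=
      (hf.fderivWithin hs (by simp)).clm_apply contDiffOn_const
    obtain ⟨g, hg, hgw⟩ := ih (Fin.tail i) hf'
    refine ⟨g, hg, fun θ hθ hc hsupp => ?_⟩
    set v : Fin (j + 1) → EuclideanSpace ℝ (Fin n) :=
      fun l => EuclideanSpace.single (i l) (1 : ℝ) with hv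
    set η : EuclideanSpace ℝ (Fin n) → ℝ := fun x => iteratedFDeriv ℝ j θ x (Fin.tail v) with hη
    have hs1 : ContDiff ℝ 1 (iteratedFDeriv ℝ j θ) :=
      hθ.iteratedFDeriv_right (m := 1) (i := j) (by exact_mod_cast le_top)
    have hη1 : ContDiff ℝ 1 η :=
      (ContinuousMultilinearMap.apply ℝ (fun _ : Fin j => EuclideanSpace ℝ (Fin n)) ℝ
        (Fin.tail v)).contDiff.comp hs1
    have hηc : HasCompactSupport η :=
      (hc.iteratedFDeriv (𝕜 := ℝ) j).comp_left
        (g := fun T : ContinuousMultilinearMap ℝ (fun _ : Fin j => EuclideanSpace ℝ (Fin n)) ℝ =>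
          T (Fin.tail v)) (by simp)
    have hηs : tsupport η ⊆ interior s := by
      refine (closure_mono ?_).trans ((tsupport_iteratedFDeriv_subset (𝕜 := ℝ) (f := θ) j).trans
        hsupp)
      exact Function.support_comp_subset (g := fun T : ContinuousMultilinearMap ℝ
        (fun _ : Fin j => EuclideanSpace ℝ (Fin n)) ℝ => T (Fin.tail v)) (by simp) _
    have hder : ∀ x, iteratedFDeriv ℝ (j + 1) θ x v = fderiv ℝ η x e := by
      intro x
      rw [iteratedFDeriv_succ_apply_left]
      have := ((ContinuousMultilinearMap.apply ℝ (fun _ : Fin j => EuclideanSpace ℝ (Fin n)) ℝ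
        (Fin.tail v)).hasFDerivAt.comp x (hs1.differentiable (by simp) x).hasFDerivAt).fderiv
      have h2 : fderiv ℝ η x = _ := this
      rw [h2]
      rfl
    have hdη : Continuous fun x => fderiv ℝ η x e :=
      (hη1.continuous_fderiv (by simp)).clm_apply continuous_const
    have hdηc : HasCompactSupport fun x => fderiv ℝ η x e :=
      (hηc.fderiv (𝕜 := ℝ)).comp_left
        (g := fun T : EuclideanSpace ℝ (Fin n) →L[ℝ] ℝ => T e) (by simp)
    have hdηs : tsupport (fun x => fderiv ℝ η x e) ⊆ interior s := by
      refine (closure_mono ?_).trans ((tsupport_fderiv_subset ℝ (f := η)).trans hηs)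
      exact Function.support_comp_subset
        (g := fun T : EuclideanSpace ℝ (Fin n) →L[ℝ] ℝ => T e) (by simp) _
    -- `fderivWithin` is smooth up to the boundary points in `s`, while integration by parts uses
    -- `fderiv`; they agree on the interior, where the test function is supported.
    have hfd : ∀ x, fderiv ℝ f x e * η x = fderivWithin ℝ f s x e * η x := by
      intro x
      by_cases hx : x ∈ tsupport η
      · rw [fderivWithin_of_mem_nhds (mem_interior_iff_mem_nhds.1 (hηs hx))]
      · rw [image_eq_zero_of_notMem_tsupport hx, mul_zero, mul_zero]
    have hparts := integral_mul_fderiv_eq_neg_fderiv_mul_of_integrable (μ := volume)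
      (f := f) (g := η) (v := e) (by
        simp only [hfd]
        exact integrable_mul_of_tsupport_subset hf'.continuousOn hη1.continuous hηc hηs)
      (integrable_mul_of_tsupport_subset hf.continuousOn hdη hdηc hdηs)
      (integrable_mul_of_tsupport_subset hf.continuousOn hη1.continuous hηc hηs)
      (fun x hx => (hf.contDiffAt (mem_interior_iff_mem_nhds.1 (hηs hx))).differentiableAt
        (by simp))
      (fun x _ => hη1.differentiable (by simp) x)
    have hind := hgw θ hθ hc hsupp
    simp_rw [hder]
    rw [hparts]
    simp_rw [hfd]
    have h3 : ∀ x, η x = iteratedFDeriv ℝ j θ x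
        (fun l => EuclideanSpace.single (Fin.tail i l) (1 : ℝ)) := fun x => rfl
    simp_rw [h3, hind]
    ring

lemma ContinuousOn.memLp_restrict {f : EuclideanSpace ℝ (Fin n) → ℝ} (hf : ContinuousOn f s)
    (p : ℝ≥0∞) {K : Set (EuclideanSpace ℝ (Fin n))} (hKs : K ⊆ s) (hK : IsCompact K) :
    MemLp f p (volume.restrict K) := by
  have : IsFiniteMeasure (volume.restrict K) := isFiniteMeasure_restrict.2 hK.measure_ne_top
  obtain ⟨C, hC⟩ := hK.exists_bound_of_continuousOn (hf.mono hKs)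
  refine MemLp.of_bound
    ((hf.mono hKs).aestronglyMeasurable_of_isCompact hK hK.measurableSet) C ?_
  exact (ae_restrict_iff' hK.measurableSet).2 (Eventually.of_forall hC)

lemma sobolevOn_of_contDiffOn (k : ℕ) (p : ℝ) {f : EuclideanSpace ℝ (Fin n) → ℝ}
    (hs : UniqueDiffOn ℝ s) (hf : ContDiffOn ℝ ∞ f s) : SobolevOn k p f s := by
  refine ⟨hf.continuousOn, fun j _ i => ?_⟩
  obtain ⟨g, hg, hw⟩ := exists_isWeakPartial i hs hf
  exact ⟨g, fun K hKs hK => ContinuousOn.memLp_restrict hg.continuousOn _ hKs hK, hw⟩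

variable {F : Type*} [AddCommGroup F] [Module ℝ F] [TopologicalSpace F]
  [IsTopologicalAddGroup F] [ContinuousSMul ℝ F]

/-- The iterated directional derivatives of `u`, in terms of partial derivatives `δ u i`. -/
def iteratedPartial (δ : (EuclideanSpace ℝ (Fin n) → F) → Fin n → EuclideanSpace ℝ (Fin n) → F) :
    (j : ℕ) → (EuclideanSpace ℝ (Fin n) → F) → EuclideanSpace ℝ (Fin n) →
      (Fin j → EuclideanSpace ℝ (Fin n)) → F
  | 0, u, y, _ => u y
  | j + 1, u, y, h => ∑ i, (h 0) i • iteratedPartial δ j (δ u i) y (Fin.tail h)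

/-- Functions whose partial derivatives are combinations of functions of the same kind are
smooth. -/
lemma mbContDiffOn_of_span (k : ℕ∞) {S : Set (EuclideanSpace ℝ (Fin n) → F)}
    (hc : ∀ u ∈ S, ContinuousOn u s)
    (hd : ∀ u ∈ S, ∃ du : Fin n → EuclideanSpace ℝ (Fin n) → F,
      (∀ i, du i ∈ Submodule.span ℝ S) ∧
      ∀ x ∈ interior s, ∀ v, HasDirDeriv u x v (∑ i, v i • du i x))
    {u : EuclideanSpace ℝ (Fin n) → F} (hu : u ∈ S) : MBContDiffOn k u s := by
  have hc' : ∀ u ∈ Submodule.span ℝ S, ContinuousOn u s := by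
    intro u hu
    induction hu using Submodule.span_induction with
    | mem u hu => exact hc u hu
    | zero => exact continuousOn_const
    | add u v _ _ hu hv => exact hu.add hv
    | smul c u _ hu => exact hu.const_smul c
  have hd' : ∀ u ∈ Submodule.span ℝ S, ∃ du : Fin n → EuclideanSpace ℝ (Fin n) → F,
      (∀ i, du i ∈ Submodule.span ℝ S) ∧
      ∀ x ∈ interior s, ∀ v, HasDirDeriv u x v (∑ i, v i • du i x) := by
    intro u hu
    induction hu using Submodule.span_induction with
    | mem u hu => exact hd u hu
    | zero =>
      refine ⟨0, fun i => zero_mem _, fun x _ v => ?_⟩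
      simpa using! HasDirDeriv.zero x v
    | add u v _ _ hu hv =>
      obtain ⟨u', hu', hu⟩ := hu
      obtain ⟨v', hv', hv⟩ := hv
      refine ⟨u' + v', fun i => add_mem (hu' i) (hv' i), fun x hx w => ?_⟩
      simpa [Finset.sum_add_distrib] using! (hu x hx w).add (hv x hx w)
    | smul c u _ hu =>
      obtain ⟨u', hu', hu⟩ := hu
      refine ⟨c • u', fun i => Submodule.smul_mem _ c (hu' i), fun x hx w => ?_⟩
      have := (hu x hx w).const_smul c
      rw [Finset.smul_sum] at this
      simp only [smul_comm c] at this
      exact this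
  choose! δ hδ hδd using hd'
  refine ⟨fun j => iteratedPartial δ j u, fun x _ h => rfl, fun j hj => ?_,
    fun j hj x hx h v => ?_⟩ <;> clear hj
  · have : ∀ u ∈ Submodule.span ℝ S, ContinuousOn (fun p : EuclideanSpace ℝ (Fin n) ×
        (Fin j → EuclideanSpace ℝ (Fin n)) => iteratedPartial δ j u p.1 p.2) (s ×ˢ univ) := by
      induction j with
      | zero => exact fun u hu => (hc' u hu).comp continuousOn_fst fun p hp => hp.1
      | succ j ih =>
        intro u hu
        refine continuousOn_finsetSum _ fun i _ => ContinuousOn.smul ?_ ?_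
        · exact Continuous.continuousOn (by fun_prop)
        · refine (ih _ (hδ u hu i)).comp (f := fun p : EuclideanSpace ℝ (Fin n) ×
            (Fin (j + 1) → EuclideanSpace ℝ (Fin n)) => (p.1, Fin.tail p.2)) ?_
            fun p hp => ⟨hp.1, mem_univ _⟩
          refine continuousOn_fst.prodMk (Continuous.continuousOn ?_)
          exact continuous_pi fun l => by unfold Fin.tail; fun_prop
    exact this u (Submodule.subset_span hu)
  -- `iteratedPartial` consumes its first direction first, whereas the new direction is appended
  -- last; so the induction needs all `u` in the span and reaches the new direction only at order
  -- zero.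
  · have : ∀ u ∈ Submodule.span ℝ S, HasDirDeriv (fun y => iteratedPartial δ j u y h) x v
        (iteratedPartial δ (j + 1) u x
          (Fin.snoc (α := fun _ => EuclideanSpace ℝ (Fin n)) h v)) := by
      induction j with
      | zero => exact fun u hu => hδd u hu x hx v
      | succ j ih =>
        intro u hu
        have h1 := HasDirDeriv.sum Finset.univ fun i _ =>
          (ih (Fin.tail h) _ (hδ u hu i)).const_smul ((h 0) i)
        have h2 : Fin.tail (Fin.snoc (α := fun _ => EuclideanSpace ℝ (Fin n)) h v) =
            Fin.snoc (α := fun _ => EuclideanSpace ℝ (Fin n)) (Fin.tail h) v := by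
          ext1 l
          induction l using Fin.lastCases with
          | last =>
            rw [Fin.tail, Fin.succ_last, Fin.snoc_last, Fin.snoc_last]
          | cast l =>
            rw [Fin.tail, Fin.succ_castSucc, Fin.snoc_castSucc, Fin.snoc_castSucc, Fin.tail]
        have h3 : Fin.snoc (α := fun _ => EuclideanSpace ℝ (Fin n)) h v 0 = h 0 := by
          exact Fin.snoc_castSucc (α := fun _ => EuclideanSpace ℝ (Fin n)) v h 0
        rw [iteratedPartial, h2, h3]
        exact h1
    exact this u (Submodule.subset_span hu)

lemma HasDirDeriv.smul {f : EuclideanSpace ℝ (Fin n) → F} {c : EuclideanSpace ℝ (Fin n) → ℝ}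
    {x v : EuclideanSpace ℝ (Fin n)} {d : F} {c' : ℝ} (hc : HasDirDeriv c x v c')
    (hf : HasDirDeriv f x v d) : HasDirDeriv (fun y => c y • f y) x v (c' • f x + c x • d) := by
  have h1 := (Tendsto.smul hc hf.tendsto).add (Tendsto.const_smul hf (c x))
  refine h1.congr fun t => ?_
  rw [smul_comm (c x), smul_eq_mul, mul_smul, ← smul_add]
  congr 1
  rw [sub_smul, smul_sub]
  abel

lemma ContDiffOn.hasDirDeriv {f : EuclideanSpace ℝ (Fin n) → ℝ} (hf : ContDiffOn ℝ ∞ f s)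
    {x : EuclideanSpace ℝ (Fin n)} (hx : x ∈ interior s) (v : EuclideanSpace ℝ (Fin n)) :
    HasDirDeriv f x v (fderivWithin ℝ f s x v) := by
  have hx' := mem_interior_iff_mem_nhds.1 hx
  rw [fderivWithin_of_mem_nhds hx']
  have := ((hf.contDiffAt hx').differentiableAt (by simp)).hasFDerivAt.hasLineDerivAt v
  have h2 := hasDerivAt_iff_tendsto_slope_zero.1 this
  simpa [HasDirDeriv] using h2

lemma IsSmoothCurveOn.hasDirDeriv_comp [LocallyConvexSpace ℝ F] {σ : ℕ → ℝ → F} {R : Set ℝ}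
    (hR : IsOpen R) (hσ : IsSmoothCurveOn σ R) {τ : EuclideanSpace ℝ (Fin n) → ℝ}
    {x v : EuclideanSpace ℝ (Fin n)} {b : ℝ} (hτ : HasDirDeriv τ x v b) (hx : τ x ∈ R) (i : ℕ) :
    HasDirDeriv (fun y => σ i (τ y)) x v (b • σ (i + 1) (τ x)) := by
  have h1 := tendsto_slope_of_hasDirDeriv' (f := σ i) (d := fun r v => v • σ (i + 1) r) hR
    (fun r hr v => by simpa using ((hσ i).2 r hr).smul_dir v)
    (continuousOn_snd.smul ((hσ (i + 1)).1.comp continuousOn_fst fun p hp => hp.1)) hx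
    (tendsto_const_nhds (x := τ x)) hτ
  refine h1.congr' ?_
  filter_upwards [self_mem_nhdsWithin] with t ht
  rw [smul_smul, mul_inv_cancel₀ ht, one_smul, add_sub_cancel]

/-- The products `c • (σ i ∘ τ)` with smooth coefficients `c` have a span closed under partial
derivatives: `∂c • (σ i ∘ τ) + (c ∂τ) • (σ (i + 1) ∘ τ)`. -/
lemma IsSmoothCurveOn.mbContDiffOn_comp [LocallyConvexSpace ℝ F] {σ : ℕ → ℝ → F} {R : Set ℝ}
    (hR : IsOpen R) (hσ : IsSmoothCurveOn σ R) (hs : UniqueDiffOn ℝ s)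
    {τ : EuclideanSpace ℝ (Fin n) → ℝ} (hτ : ContDiffOn ℝ ∞ τ s) (hτR : MapsTo τ s R) (k : ℕ∞) :
    MBContDiffOn k (fun y => σ 0 (τ y)) s := by
  set S : Set (EuclideanSpace ℝ (Fin n) → F) :=
    {u | ∃ (c : EuclideanSpace ℝ (Fin n) → ℝ) (i : ℕ), ContDiffOn ℝ ∞ c s ∧
      u = fun y => c y • σ i (τ y)} with hS
  have hmem : ∀ {c : EuclideanSpace ℝ (Fin n) → ℝ} (i : ℕ), ContDiffOn ℝ ∞ c s →
      (fun y => c y • σ i (τ y)) ∈ S := fun i hc => ⟨_, i, hc, rfl⟩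
  have hpart : ∀ {c : EuclideanSpace ℝ (Fin n) → ℝ} (i : Fin n), ContDiffOn ℝ ∞ c s →
      ContDiffOn ℝ ∞ (fun x => fderivWithin ℝ c s x (EuclideanSpace.single i (1 : ℝ))) s :=
    fun i hc => (hc.fderivWithin hs (by simp)).clm_apply contDiffOn_const
  have hexp : ∀ (T : EuclideanSpace ℝ (Fin n) →L[ℝ] ℝ) (v : EuclideanSpace ℝ (Fin n)),
      T v = ∑ i, v i * T (EuclideanSpace.single i (1 : ℝ)) := by
    intro T v
    conv_lhs => rw [← (EuclideanSpace.basisFun (Fin n) ℝ).sum_repr v]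
    simp
  have hSc : ∀ u ∈ S, ContinuousOn u s := by
    rintro _ ⟨c, i, hc, rfl⟩
    exact hc.continuousOn.smul ((hσ i).1.comp hτ.continuousOn hτR)
  refine mbContDiffOn_of_span k (S := S) hSc ?_ (u := fun y => σ 0 (τ y)) ?_
  · rintro _ ⟨c, i, hc, rfl⟩
    refine ⟨fun l => (fun x => fderivWithin ℝ c s x (EuclideanSpace.single l (1 : ℝ)) •
        σ i (τ x)) + fun x => (c x * fderivWithin ℝ τ s x (EuclideanSpace.single l (1 : ℝ))) •
        σ (i + 1) (τ x), fun l => add_mem (Submodule.subset_span (hmem _ (hpart l hc)))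
        (Submodule.subset_span (hmem _ (hc.mul (hpart l hτ)))), fun x hx v => ?_⟩
    have h1 := HasDirDeriv.smul (ContDiffOn.hasDirDeriv hc hx v)
      (hσ.hasDirDeriv_comp hR (ContDiffOn.hasDirDeriv hτ hx v) (hτR (interior_subset hx)) i)
    convert h1 using 1
    rw [hexp (fderivWithin ℝ c s x) v, hexp (fderivWithin ℝ τ s x) v]
    simp only [Pi.add_apply, smul_add, Finset.sum_add_distrib, Finset.sum_smul, Finset.smul_sum,
      smul_smul]
    congr 1
    refine Finset.sum_congr rfl fun l _ => ?_
    congr 1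
    ring
  · simpa using hmem (c := fun _ => 1) 0 contDiffOn_const

lemma IsSmoothCurveOn.contDiffOn {B : Type*} [NormedAddCommGroup B] [NormedSpace ℝ B]
    {σ : ℕ → ℝ → F} {R : Set ℝ} (hR : IsOpen R) (hσ : IsSmoothCurveOn σ R) (L : F →L[ℝ] B) :
    ContDiffOn ℝ ∞ (fun r => L (σ 0 r)) R := by
  have hder : ∀ i, ∀ r ∈ R, HasDerivAt (fun r => L (σ i r)) (L (σ (i + 1) r)) r := by
    intro i r hr
    rw [hasDerivAt_iff_tendsto_slope_zero]
    refine ((L.continuous.tendsto _).comp ((hσ i).2 r hr)).congr fun t => ?_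
    simp
  have : ∀ k i : ℕ, ContDiffOn ℝ k (fun r => L (σ i r)) R := by
    intro k
    induction k with
    | zero =>
      intro i
      simpa using! L.continuous.comp_continuousOn (hσ i).1
    | succ k ih =>
      intro i
      push_cast
      rw [contDiffOn_succ_iff_deriv_of_isOpen hR]
      refine ⟨fun r hr => (hder i r hr).differentiableAt.differentiableWithinAt, by simp, ?_⟩
      exact (ih (i + 1)).congr fun r hr => (hder i r hr).deriv
  exact contDiffOn_infty.2 fun k => this k 0

/-- The composition of a smooth curve with a smooth scalar function is of every class. -/
lemma SmoothnessClass.on_curve_comp (𝓕 : SmoothnessClass) [LocallyConvexSpace ℝ F] {σ : ℕ → ℝ → F}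
    (h𝓕 : 𝓕.Admissible n F) {R : Set ℝ}
    (hR : IsOpen R) (hσ : IsSmoothCurveOn σ R) (hs : UniqueDiffOn ℝ s) (hconv : Convex ℝ s)
    {τ : EuclideanSpace ℝ (Fin n) → ℝ} (hτ : ContDiffOn ℝ ∞ τ s) (hτR : MapsTo τ s R) :
    𝓕.On (fun y => σ 0 (τ y)) s := by
  cases 𝓕 with
  | mb k => exact hσ.mbContDiffOn_comp hR hs hτ hτR k
  | frechet k =>
    intro B _ _ _ L
    exact ((hσ.contDiffOn hR (L : F →L[ℝ] B)).comp hτ hτR).of_le (by exact_mod_cast le_top)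
  | holder k α =>
    intro ℓ
    exact holderOn_of_contDiffOn h𝓕.2.1 h𝓕.2.2 hs hconv ((hσ.contDiffOn hR ℓ).comp hτ hτR)
  | sobolev k p =>
    intro ℓ
    exact sobolevOn_of_contDiffOn k p hs ((hσ.contDiffOn hR ℓ).comp hτ hτR)

end ClassesOfComposites

/-! ### Locality and linearity of the smoothness classes. -/

section ClassClosure

set_option linter.unusedSectionVars false

variable {n : ℕ} {s : Set (EuclideanSpace ℝ (Fin n))}
  {E : Type u} [AddCommGroup E] [Module ℝ E] [TopologicalSpace E]

/-- Test functions live in the interior of `s`, so values of `f` outside `s` do not enter the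
integrals. -/
lemma IsWeakPartial.congr {j : ℕ} {i : Fin j → Fin n} {f f' g : EuclideanSpace ℝ (Fin n) → ℝ}
    (h : IsWeakPartial i f g s) (hff' : EqOn f' f s) : IsWeakPartial i f' g s := by
  intro θ hθ hc hs
  rw [← h θ hθ hc hs]
  congr 1
  ext x
  by_cases hx : x ∈ tsupport θ
  · rw [hff' (interior_subset (hs hx))]
  · have : iteratedFDeriv ℝ j θ x = 0 :=
      image_eq_zero_of_notMem_tsupport fun hx' => hx (tsupport_iteratedFDeriv_subset j hx')
    simp [this]

lemma SmoothnessClass.On.congr {𝓕 : SmoothnessClass} {f f' : EuclideanSpace ℝ (Fin n) → E}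
    (h : 𝓕.On f s) (hff' : EqOn f' f s) : 𝓕.On f' s := by
  cases 𝓕 with
  | mb k =>
    obtain ⟨D, h0, hc, hd⟩ := h
    exact ⟨D, fun x hx h => (h0 x hx h).trans (hff' hx).symm, hc, hd⟩
  | frechet k =>
    intro B _ _ _ L
    exact (h B L).congr fun x hx => by rw [hff' hx]
  | holder k α =>
    intro ℓ
    have heq : EqOn (fun x => ℓ (f' x)) (fun x => ℓ (f x)) s := fun x hx => by simp only [hff' hx]
    refine ⟨(h ℓ).1.congr heq, fun x hx => ?_⟩
    obtain ⟨T, hT, C, hC⟩ := (h ℓ).2 x hx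
    refine ⟨T, hT, C, fun y hy z hz => ?_⟩
    rw [iteratedFDerivWithin_congr heq hy.2, iteratedFDerivWithin_congr heq hz.2]
    exact hC y hy z hz
  | sobolev k p =>
    intro ℓ
    have heq : EqOn (fun x => ℓ (f' x)) (fun x => ℓ (f x)) s := fun x hx => by simp only [hff' hx]
    refine ⟨(h ℓ).1.congr heq, fun j hj i => ?_⟩
    obtain ⟨g, hg, hw⟩ := (h ℓ).2 j hj i
    exact ⟨g, hg, hw.congr heq⟩

lemma SmoothnessClass.On.inter_isOpen {𝓕 : SmoothnessClass} {f : EuclideanSpace ℝ (Fin n) → E}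
    (h : 𝓕.On f s) {O : Set (EuclideanSpace ℝ (Fin n))} (hO : IsOpen O) : 𝓕.On f (s ∩ O) := by
  have hsub : s ∩ O ⊆ s := inter_subset_left
  cases 𝓕 with
  | mb k =>
    obtain ⟨D, h0, hc, hd⟩ := h
    exact ⟨D, fun x hx => h0 x (hsub hx), fun j hj => (hc j hj).mono (prod_mono_left hsub),
      fun j hj x hx => hd j hj x (interior_mono hsub hx)⟩
  | frechet k =>
    intro B _ _ _ L
    exact (h B L).mono hsub
  | holder k α =>
    intro ℓ
    refine ⟨(h ℓ).1.mono hsub, fun x hx => ?_⟩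
    obtain ⟨T, hT, C, hC⟩ := (h ℓ).2 x hx.1
    refine ⟨T, nhdsWithin_mono _ hsub hT, C, fun y hy z hz => ?_⟩
    rw [iteratedFDerivWithin_inter_open hO hy.2.2, iteratedFDerivWithin_inter_open hO hz.2.2]
    exact hC y ⟨hy.1, hy.2.1⟩ z ⟨hz.1, hz.2.1⟩
  | sobolev k p =>
    intro ℓ
    refine ⟨(h ℓ).1.mono hsub, fun j hj i => ?_⟩
    obtain ⟨g, hg, hw⟩ := (h ℓ).2 j hj i
    exact ⟨g, fun K hK => hg K (hK.trans hsub),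
      fun θ hθ hc hs => hw θ hθ hc (hs.trans (interior_mono hsub))⟩

lemma HolderOn.sum {ι : Type*} (S : Finset ι) {k : ℕ} {α : ℝ}
    {f : ι → EuclideanSpace ℝ (Fin n) → ℝ} (hs : UniqueDiffOn ℝ s)
    (hf : ∀ i ∈ S, HolderOn k α (f i) s) : HolderOn k α (fun x => ∑ i ∈ S, f i x) s := by
  classical
  induction S using Finset.induction_on with
  | empty => simpa using holderOn_const k α 0 s
  | insert i S hi ih =>
    simp only [Finset.sum_insert hi]
    have h1 := hf i (Finset.mem_insert_self i S)
    have h2 := ih fun l hl => hf l (Finset.mem_insert_of_mem hl)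
    refine ⟨h1.1.add h2.1, fun x hx => ?_⟩
    obtain ⟨T, hT, C, hC⟩ := h1.2 x hx
    obtain ⟨T', hT', C', hC'⟩ := h2.2 x hx
    refine ⟨T ∩ T', inter_mem hT hT', C + C', fun y hy z hz => ?_⟩
    have hadd : ∀ w ∈ s, iteratedFDerivWithin ℝ k (fun x => f i x + ∑ l ∈ S, f l x) s w =
        iteratedFDerivWithin ℝ k (f i) s w +
          iteratedFDerivWithin ℝ k (fun x => ∑ l ∈ S, f l x) s w :=
      fun w hw => iteratedFDerivWithin_add_apply (h1.1 w hw) (h2.1 w hw) hs hw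
    rw [hadd y hy.2, hadd z hz.2, add_sub_add_comm, add_mul]
    exact (norm_add_le _ _).trans (add_le_add (hC y ⟨hy.1.1, hy.2⟩ z ⟨hz.1.1, hz.2⟩)
      (hC' y ⟨hy.1.2, hy.2⟩ z ⟨hz.1.2, hz.2⟩))

lemma integrable_mul_of_memLp {p : ℝ≥0∞} (hp : 1 ≤ p) {g θ : EuclideanSpace ℝ (Fin n) → ℝ}
    (hg : ∀ K ⊆ s, IsCompact K → MemLp g p (volume.restrict K)) (hθ : Continuous θ)
    (hc : HasCompactSupport θ) (hs : tsupport θ ⊆ interior s) :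
    Integrable (fun x => g x * θ x) := by
  have hK : IsCompact (tsupport θ) := hc
  have : IsFiniteMeasure (volume.restrict (tsupport θ)) :=
    isFiniteMeasure_restrict.2 hK.measure_ne_top
  have h1 : IntegrableOn g (tsupport θ) :=
    (hg _ (hs.trans interior_subset) hK).integrable hp
  have h2 : IntegrableOn (fun x => g x * θ x) (tsupport θ) :=
    h1.mul_continuousOn hθ.continuousOn hK
  exact h2.integrable_of_forall_notMem_eq_zero fun x hx => by
    rw [image_eq_zero_of_notMem_tsupport hx, mul_zero]

lemma SobolevOn.sum {ι : Type*} (S : Finset ι) {k : ℕ} {p : ℝ} (hp : 1 ≤ p)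
    {f : ι → EuclideanSpace ℝ (Fin n) → ℝ} (hf : ∀ i ∈ S, SobolevOn k p (f i) s) :
    SobolevOn k p (fun x => ∑ i ∈ S, f i x) s := by
  classical
  induction S using Finset.induction_on with
  | empty => simpa using sobolevOn_const k p 0 s
  | insert i S hi ih =>
    simp only [Finset.sum_insert hi]
    have h1 := hf i (Finset.mem_insert_self i S)
    have h2 := ih fun l hl => hf l (Finset.mem_insert_of_mem hl)
    refine ⟨h1.1.add h2.1, fun j hj a => ?_⟩
    obtain ⟨g, hg, hw⟩ := h1.2 j hj a
    obtain ⟨g', hg', hw'⟩ := h2.2 j hj a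
    refine ⟨fun x => g x + g' x, fun K hK hKc => (hg K hK hKc).add (hg' K hK hKc),
      fun θ hθ hc hs => ?_⟩
    have hp' : 1 ≤ ENNReal.ofReal p := ENNReal.one_le_ofReal.2 hp
    have hD : Continuous fun x => iteratedFDeriv ℝ j θ x
        (fun l => EuclideanSpace.single (a l) (1 : ℝ)) :=
      (ContinuousMultilinearMap.apply ℝ (fun _ : Fin j => EuclideanSpace ℝ (Fin n)) ℝ
        _).continuous.comp (hθ.continuous_iteratedFDeriv (by exact_mod_cast le_top))
    have hDc : HasCompactSupport fun x => iteratedFDeriv ℝ j θ x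
        (fun l => EuclideanSpace.single (a l) (1 : ℝ)) :=
      (hc.iteratedFDeriv (𝕜 := ℝ) j).comp_left
        (g := fun T : ContinuousMultilinearMap ℝ (fun _ : Fin j => EuclideanSpace ℝ (Fin n)) ℝ =>
          T (fun l => EuclideanSpace.single (a l) (1 : ℝ))) (by simp)
    have hDs : tsupport (fun x => iteratedFDeriv ℝ j θ x
        (fun l => EuclideanSpace.single (a l) (1 : ℝ))) ⊆ interior s := by
      refine (closure_mono ?_).trans
        ((tsupport_iteratedFDeriv_subset (𝕜 := ℝ) (f := θ) j).trans hs)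
      exact Function.support_comp_subset (g := fun T : ContinuousMultilinearMap ℝ
        (fun _ : Fin j => EuclideanSpace ℝ (Fin n)) ℝ =>
          T (fun l => EuclideanSpace.single (a l) (1 : ℝ))) (by simp) _
    simp only [add_mul]
    rw [integral_add (integrable_mul_of_tsupport_subset h1.1 hD hDc hDs)
      (integrable_mul_of_tsupport_subset h2.1 hD hDc hDs),
      integral_add (integrable_mul_of_memLp hp' hg hθ.continuous hc hs)
      (integrable_mul_of_memLp hp' hg' hθ.continuous hc hs), hw θ hθ hc hs, hw' θ hθ hc hs, mul_add]

lemma HasDirDeriv.clm_comp {X E' : Type*} [AddCommGroup X] [Module ℝ X] [TopologicalSpace X]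
    [AddCommGroup E'] [Module ℝ E'] [TopologicalSpace E']
    {f : X → E} {x v : X} {d : E} (hf : HasDirDeriv f x v d) (Λ : E →L[ℝ] E') :
    HasDirDeriv (fun y => Λ (f y)) x v (Λ d) := by
  refine ((Λ.continuous.tendsto d).comp hf).congr fun t => ?_
  simp

variable {E' : Type u} [AddCommGroup E'] [Module ℝ E'] [TopologicalSpace E']
  [IsTopologicalAddGroup E'] [ContinuousSMul ℝ E']

lemma SmoothnessClass.On.sum_clm {𝓕 : SmoothnessClass} (h𝓕 : 𝓕.Admissible n E)
    (hs : UniqueDiffOn ℝ s) {ι : Type*} [Fintype ι] {f : ι → EuclideanSpace ℝ (Fin n) → E}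
    (hf : ∀ i, 𝓕.On (f i) s) (Λ : ι → E →L[ℝ] E') : 𝓕.On (fun x => ∑ i, Λ i (f i x)) s := by
  cases 𝓕 with
  | mb k =>
    choose D h0 hc hd using hf
    refine ⟨fun j x h => ∑ i, Λ i (D i j x h), fun x hx h => by simp only [h0 _ x hx],
      fun j hj => ?_, fun j hj x hx h v => ?_⟩
    · exact continuousOn_finsetSum _ fun i _ => (Λ i).continuous.comp_continuousOn (hc i j hj)
    · exact HasDirDeriv.sum Finset.univ fun i _ => (hd i j hj x hx h v).clm_comp (Λ i)
  | frechet k =>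
    intro B _ _ _ L
    -- A Banach model of `E` turns `L ∘ Λ i` into a continuous linear map between normed spaces.
    obtain ⟨B₀, _, _, _, ⟨M⟩⟩ := h𝓕
    have h1 : ∀ i, ContDiffOn ℝ (k : WithTop ℕ∞) (fun x => L (Λ i (f i x))) s := by
      intro i
      have h2 := (((L : E' →L[ℝ] B).comp (Λ i)).comp
        (M.symm : B₀ →L[ℝ] E)).contDiff.comp_contDiffOn (hf i B₀ M)
      refine h2.congr fun x _ => ?_
      simp
    refine (ContDiffOn.sum (s := Finset.univ) fun i _ => h1 i).congr fun x _ => ?_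
    simp
  | holder k α =>
    intro ℓ
    simp only [map_sum]
    exact HolderOn.sum Finset.univ hs fun i _ => hf i (ℓ.comp (Λ i))
  | sobolev k p =>
    intro ℓ
    simp only [map_sum]
    exact SobolevOn.sum Finset.univ h𝓕.2.2.1 fun i _ => hf i (ℓ.comp (Λ i))

variable {H : Type*} [TopologicalSpace H] {I : ModelWithCorners ℝ (EuclideanSpace ℝ (Fin n)) H}
  {M : Type*} [TopologicalSpace M] [ChartedSpace H M]

/-- Functions that are locally sums of linear images of functions of class `𝓕` are of class
`𝓕`. -/
lemma ClassNear.sum_clm {𝓕 : SmoothnessClass} (h𝓕 : 𝓕.Admissible n E) {ι : Type*} [Fintype ι]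
    {f : ι → M → E} {m : M} (hf : ∀ i, ClassNear 𝓕 I (f i) m) (Λ : ι → E →L[ℝ] E') {g : M → E'}
    (hg : ∀ᶠ m' in 𝓝 m, g m' = ∑ i, Λ i (f i m')) : ClassNear 𝓕 I g m := by
  intro e he hm
  choose O hO hmO hfO using fun i => hf i e he hm
  have hN := (e.continuousAt_extend_symm (I := I) hm).eventually
    (by rw [e.extend_left_inv hm]; exact hg)
  obtain ⟨N, hN, hNo, hmN⟩ := eventually_nhds_iff.1 hN
  have hO' : IsOpen (N ∩ ⋂ i, O i) := hNo.inter (isOpen_iInter_of_finite hO)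
  refine ⟨N ∩ ⋂ i, O i, hO', ⟨hmN, mem_iInter.2 hmO⟩, ?_⟩
  have hsub : ∀ i, (N ∩ ⋂ i, O i) ∩ (e.extend I).target =
      (O i ∩ (e.extend I).target) ∩ (N ∩ ⋂ i, O i) := by
    intro i
    ext y
    simp only [mem_inter_iff, mem_iInter]
    exact ⟨fun h => ⟨⟨h.1.2 i, h.2⟩, h.1⟩, fun h => ⟨h.2, h.1.2⟩⟩
  have hud : UniqueDiffOn ℝ ((N ∩ ⋂ i, O i) ∩ (e.extend I).target) := by
    rw [e.extend_target, ← inter_assoc, inter_comm]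
    exact I.uniqueDiffOn.inter (hO'.inter (e.open_target.preimage I.continuous_symm))
  refine (SmoothnessClass.On.sum_clm h𝓕 hud (fun i => ?_) Λ).congr fun y hy => hN y hy.1.1
  rw [hsub i]
  exact (hfO i).inter_isOpen hO'

end ClassClosure

/-! ### Null-homotopic maps built from the exponential map. -/

section ExponentialCurves

variable {E : Type u} [AddCommGroup E] [Module ℝ E] [TopologicalSpace E]
  [IsTopologicalAddGroup E] [ContinuousSMul ℝ E] [LocallyConvexSpace ℝ E] [T2Space E]
  {G : Type*} [TopologicalSpace G] [ChartedSpace E G]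

/-- The line `r ↦ r • a` is composed first with `exp` in an atlas chart `e`, where its smoothness is
given, and then with the transition from `e` to the arbitrary smooth chart `c`. -/
lemma exists_isSmoothCurveOn_chart_exp {exp : E → G} (hexp : Continuous exp)
    (hsm : ∀ e ∈ atlas E G, MBContDiffOn ⊤ (fun a => e (exp a)) (exp ⁻¹' e.source))
    {c : OpenPartialHomeomorph G E} (hc : IsSmoothChart c) (a : E) {r₀ : ℝ}
    (hr₀ : exp (r₀ • a) ∈ c.source) :
    ∃ (R : Set ℝ) (σ : ℕ → ℝ → E), IsOpen R ∧ r₀ ∈ R ∧ IsSmoothCurveOn σ R ∧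
      ∀ r ∈ R, σ 0 r = c (exp (r • a)) := by
  set e := chartAt E (exp (r₀ • a)) with he
  have hea : e ∈ atlas E G := chart_mem_atlas E _
  have hcont : Continuous fun r : ℝ => exp (r • a) := hexp.comp (by fun_prop)
  set R : Set ℝ := (fun r : ℝ => exp (r • a)) ⁻¹' (e.source ∩ c.source) with hR
  have hRo : IsOpen R := (e.open_source.inter c.open_source).preimage hcont
  set η : ℕ → ℝ → E := fun i r => match i with
    | 0 => r • a
    | 1 => a
    | _ + 2 => 0 with hη
  have hηs : IsSmoothCurveOn η R := by
    intro i
    match i with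
    | 0 =>
      refine ⟨Continuous.continuousOn (by simp only [hη]; fun_prop), fun r _ => ?_⟩
      refine (tendsto_const_nhds (x := a)).congr' ?_
      filter_upwards [self_mem_nhdsWithin] with t ht
      simp only [hη, smul_eq_mul, mul_one, add_smul, add_sub_cancel_left, smul_smul]
      rw [inv_mul_cancel₀ ht, one_smul]
    | 1 => exact ⟨continuousOn_const, fun r _ => by
        simp [HasDirDeriv, hη]⟩
    | i + 2 => exact ⟨continuousOn_const, fun r _ => by
        simp [HasDirDeriv, hη]⟩
  obtain ⟨ζ, hζ, hζ0⟩ := MBContDiffOn.comp_curve (e.open_source.preimage hexp) (hsm e hea) hηs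
    (fun r hr => hr.1)
  have hopen : IsOpen {b | b ∈ e.target ∧ e.symm b ∈ c.source} :=
    e.symm.isOpen_inter_preimage c.open_source
  have hmaps : MapsTo (ζ 0) R {b | b ∈ e.target ∧ e.symm b ∈ c.source} := by
    intro r hr
    rw [hζ0 r hr]
    refine ⟨e.map_source hr.1, ?_⟩
    rw [e.left_inv hr.1]
    exact hr.2
  obtain ⟨σ, hσ, hσ0⟩ := MBContDiffOn.comp_curve hopen (hc e hea).2 hζ hmaps
  refine ⟨R, σ, hRo, ⟨mem_chart_source E _, hr₀⟩, hσ, fun r hr => ?_⟩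
  rw [hσ0 r hr, hζ0 r hr, e.left_inv hr.1]

variable {n : ℕ} {H : Type*} [TopologicalSpace H]
  {I : ModelWithCorners ℝ (EuclideanSpace ℝ (Fin n)) H}
  {V : Type*} [TopologicalSpace V] [ChartedSpace H V]

/-- The map `v ↦ exp (τ(v) a)` is of every class if `τ` is a smooth function. -/
lemma isClassMap_exp_smul {𝓕 : SmoothnessClass} (h𝓕 : 𝓕.Admissible n E) {exp : E → G}
    (hexp : Continuous exp)
    (hsm : ∀ e ∈ atlas E G, MBContDiffOn ⊤ (fun a => e (exp a)) (exp ⁻¹' e.source))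
    {τ : V → ℝ} (hτ : ContMDiff I 𝓘(ℝ, ℝ) ∞ τ) (a : E) :
    IsClassMap 𝓕 I E (fun v => exp (τ v • a)) := by
  refine ⟨hexp.comp (hτ.continuous.smul continuous_const), fun m c hc hm e he hme => ?_⟩
  obtain ⟨R, σ, hR, hmR, hσ, hσ0⟩ := exists_isSmoothCurveOn_chart_exp hexp hsm hc a hm
  have hN : ∀ᶠ y in 𝓝 (e.extend I m), τ ((e.extend I).symm y) ∈ R := by
    have h1 : ContinuousAt (fun y => τ ((e.extend I).symm y)) (e.extend I m) :=
      hτ.continuous.continuousAt.comp (e.continuousAt_extend_symm (I := I) hme)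
    refine h1.eventually (hR.mem_nhds ?_)
    change τ ((e.extend I).symm (e.extend I m)) ∈ R
    rwa [e.extend_left_inv hme]
  have hT : I.symm ⁻¹' e.target ∈ 𝓝 (e.extend I m) := by
    refine (e.open_target.preimage I.continuous_symm).mem_nhds ?_
    simp [e.map_source hme]
  obtain ⟨ε, hε, hball⟩ := Metric.mem_nhds_iff.1 (inter_mem hN hT)
  -- A small ball cut with the range of the model is convex and has unique derivatives, also at
  -- boundary points.
  refine ⟨Metric.ball (e.extend I m) ε, Metric.isOpen_ball, Metric.mem_ball_self hε, ?_⟩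
  have hs : Metric.ball (e.extend I m) ε ∩ (e.extend I).target =
      range I ∩ Metric.ball (e.extend I m) ε := by
    rw [e.extend_target, inter_comm (I.symm ⁻¹' e.target), ← inter_assoc,
      inter_comm (Metric.ball _ _), inter_eq_left]
    exact fun y hy => (hball hy.2).2
  have hud : UniqueDiffOn ℝ (Metric.ball (e.extend I m) ε ∩ (e.extend I).target) := by
    rw [hs]
    exact I.uniqueDiffOn.inter Metric.isOpen_ball
  have hconv : Convex ℝ (Metric.ball (e.extend I m) ε ∩ (e.extend I).target) := by
    rw [hs]
    exact I.convex_range.inter (convex_ball _ _)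
  have hτs : ContDiffOn ℝ ∞ (fun y => τ ((e.extend I).symm y))
      (Metric.ball (e.extend I m) ε ∩ (e.extend I).target) := by
    rw [← contMDiffOn_iff_contDiffOn]
    refine hτ.comp_contMDiffOn ((contMDiffOn_extend_symm he).mono ?_)
    rw [e.extend_target']
    exact inter_subset_right
  have hmaps : MapsTo (fun y => τ ((e.extend I).symm y))
      (Metric.ball (e.extend I m) ε ∩ (e.extend I).target) R := fun y hy => (hball hy.1).1
  exact (SmoothnessClass.on_curve_comp 𝓕 h𝓕 hR hσ hud hconv hτs hmaps).congr
    fun y hy => (hσ0 _ (hmaps hy)).symm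

variable {G : Type*} [Group G] [TopologicalSpace G] [IsTopologicalGroup G] [ChartedSpace E G]

/-- At every point of `V`, some compactly null-homotopic map takes a prescribed value
`exp a`. -/
lemma exists_mem_nullGroup_apply_eq_exp [T2Space V] [IsManifold I ∞ V] {𝓕 : SmoothnessClass}
    (h𝓕 : 𝓕.Admissible n E) {exp : E → G} (hexp : Continuous exp) (h0 : exp 0 = 1)
    (hsm : ∀ e ∈ atlas E G, MBContDiffOn ⊤ (fun a => e (exp a)) (exp ⁻¹' e.source))
    (v₀ : V) (a : E) :
    ∃ y ∈ nullGroup 𝓕 I V E G, (y : V → G) v₀ = exp a := by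
  obtain ⟨θ⟩ : Nonempty (SmoothBumpFunction I v₀) := inferInstance
  have hmem : ∀ t : ℝ, (fun v => exp ((t * θ v) • a)) ∈ mappingGroup 𝓕 I V E G := fun t =>
    Subgroup.subset_closure (isClassMap_exp_smul h𝓕 hexp hsm
      (contMDiff_const.mul θ.contMDiff) a)
  -- Scaling the bump function by `t` gives the homotopy; all its stages are `1` outside the compact
  -- support of `θ`.
  refine ⟨⟨fun v => exp ((1 * θ v) • a), hmem 1⟩, ⟨tsupport θ, θ.hasCompactSupport,
    fun v hv => ?_, fun q => exp (((q.1 : ℝ) * θ q.2) • a), ?_, ?_, ?_, ?_, ?_⟩, ?_⟩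
  · simp [image_eq_zero_of_notMem_tsupport hv, h0]
  · have := θ.continuous
    exact hexp.comp (by fun_prop)
  · simp [h0]
  · simp
  · intro t v hv
    simp [image_eq_zero_of_notMem_tsupport hv, h0]
  · exact fun t => hmem t
  · simp

end ExponentialCurves

/-! ### One-parameter subgroups and their images under automorphisms. -/

section OneParameterSubgroups

set_option linter.unusedSectionVars false

variable {G : Type*} [Group G] [TopologicalSpace G]

/-- A family of one-parameter subgroups that is pointwise continuous at `w₀` is locally
equicontinuous at `0`. -/
lemma exists_eventually_forall_mem_of_pointwise [IsTopologicalGroup G] {W : Type*}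
    [TopologicalSpace W]
    {X : W → ℝ → G} (hX : ∀ w s t, X w (s + t) = X w s * X w t) (hXc : ∀ w, Continuous (X w))
    {w₀ : W} [(𝓝 w₀).IsCountablyGenerated] (hw₀ : ∀ t, ContinuousAt (fun w => X w t) w₀)
    {U : Set G} (hU : U ∈ 𝓝 (1 : G)) :
    ∃ δ > 0, ∀ᶠ w in 𝓝 w₀, ∀ s ∈ Icc (0 : ℝ) δ, X w s ∈ U := by
  have hX0 : ∀ w, X w 0 = 1 := fun w => by simpa using hX w 0 0
  have hcont : Tendsto (fun q : G × G × G => q.1⁻¹ * q.2.1 * q.2.2) (𝓝 (1 : G) ×ˢ 𝓝 1 ×ˢ 𝓝 1)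
      (𝓝 1) := by
    have h : Continuous fun q : G × G × G => q.1⁻¹ * q.2.1 * q.2.2 := by fun_prop
    simpa [nhds_prod_eq] using h.tendsto (1, 1, 1)
  obtain ⟨N₁, hN₁, N', hN', hmem⟩ := Filter.mem_prod_iff.1 (hcont hU)
  obtain ⟨N₂, hN₂, N₃, hN₃, hmem'⟩ := Filter.mem_prod_iff.1 hN'
  obtain ⟨N, hN, hNcl, hNsub⟩ := exists_mem_nhds_isClosed_subset (inter_mem hN₁ hN₃)
  obtain ⟨B, hB⟩ := (𝓝 w₀).exists_antitone_basis
  -- Baire category: these closed sets cover `ℝ` by pointwise continuity at `w₀`, so one of them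
  -- contains an interval, on which closeness is uniform in `w`.
  set T : ℕ → Set ℝ := fun m => {t | ∀ w ∈ B m, (X w₀ t)⁻¹ * X w t ∈ N} with hT
  have hTcl : ∀ m, IsClosed (T m) := by
    intro m
    simp only [hT, ofPred_forall]
    exact isClosed_biInter fun w _ => hNcl.preimage ((hXc w₀).inv.mul (hXc w))
  have hTun : ⋃ m, T m = univ := by
    refine eq_univ_of_forall fun t => mem_iUnion.2 ?_
    have h1 : Tendsto (fun w => (X w₀ t)⁻¹ * X w t) (𝓝 w₀) (𝓝 1) := by
      simpa using (hw₀ t).tendsto.const_mul (X w₀ t)⁻¹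
    obtain ⟨m, -, hm⟩ := hB.1.mem_iff.1 (h1 hN)
    exact ⟨m, fun w hw => hm hw⟩
  obtain ⟨m, t₀, ht₀⟩ := nonempty_interior_of_iUnion_of_closed hTcl hTun
  have h1 : ∀ᶠ s : ℝ in 𝓝 0, t₀ + s ∈ T m := by
    have : ContinuousAt (fun s : ℝ => t₀ + s) 0 := by fun_prop
    exact this.eventually_mem (by simpa using mem_interior_iff_mem_nhds.1 ht₀)
  have h2 : ∀ᶠ s : ℝ in 𝓝 0, X w₀ s ∈ N₂ :=
    (hXc w₀).continuousAt.eventually_mem (by rwa [hX0])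
  obtain ⟨ε, hε, hball⟩ := Metric.eventually_nhds_iff.1 (h1.and h2)
  refine ⟨ε / 2, by positivity, ?_⟩
  filter_upwards [hB.1.mem_of_mem (i := m) trivial] with w hw s hs
  have hs' := hball (y := s) (by
    rw [Real.dist_eq, sub_zero, abs_of_nonneg hs.1]
    linarith [hs.2])
  have h3 := interior_subset ht₀ w hw
  have h4 := hs'.1 w hw
  have h5 := @hmem ((X w₀ t₀)⁻¹ * X w t₀, X w₀ s, (X w₀ (t₀ + s))⁻¹ * X w (t₀ + s))
    ⟨(hNsub h3).1, hmem' ⟨hs'.2, (hNsub h4).2⟩⟩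
  -- This identity transports the uniform estimate from the interval around `t₀` to times near `0`.
  have h6 : ((X w₀ t₀)⁻¹ * X w t₀)⁻¹ * X w₀ s * ((X w₀ (t₀ + s))⁻¹ * X w (t₀ + s)) = X w s := by
    simp only [hX]
    group
  rw [← h6]
  exact h5

variable {E : Type u} [AddCommGroup E] [Module ℝ E] [TopologicalSpace E]
  {exp : E → G}

lemma exp_zero_of_add
    (hadd : ∀ (a : E) (s t : ℝ), exp ((s + t) • a) = exp (s • a) * exp (t • a)) : exp 0 = 1 := by
  simpa using hadd 0 0 0

lemma exp_neg_of_add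
    (hadd : ∀ (a : E) (s t : ℝ), exp ((s + t) • a) = exp (s • a) * exp (t • a))
    (a : E) (t : ℝ) : exp ((-t) • a) = (exp (t • a))⁻¹ := by
  rw [eq_inv_iff_mul_eq_one, ← hadd, neg_add_cancel, zero_smul, exp_zero_of_add hadd]

variable [IsTopologicalAddGroup E] [ContinuousSMul ℝ E] [T2Space E]
  {c : OpenPartialHomeomorph G E}

/-- `exp` need not be injective, so the endpoint alone does not determine its logarithm. Along the
whole segment, the times at which `c` inverts `exp` form a closed set containing `0`, and it is open
to the right because `c.target` is open. -/
lemma chart_exp_smul_of_forall_mem (hexp : Continuous exp)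
    (hc0 : (0 : E) ∈ c.target) (hcexp : ∀ a ∈ c.target, c.symm a = exp a)
    {b : E} {δ : ℝ}
    (hb : ∀ s ∈ Icc (0 : ℝ) δ, exp (s • b) ∈ c.source) :
    ∀ s ∈ Icc (0 : ℝ) δ, c (exp (s • b)) = s • b := by
  have hlog : ∀ a ∈ c.target, c (exp a) = a := fun a ha => by
    rw [← hcexp a ha, c.right_inv ha]
  have hcont : Continuous fun s : ℝ => exp (s • b) := hexp.comp (by fun_prop)
  set Z : Set ℝ := {s | c (exp (s • b)) = s • b} with hZ
  change Icc 0 δ ⊆ Z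
  refine IsClosed.Icc_subset_of_forall_mem_nhdsWithin ?_ ?_ ?_
  · have h1 : ContinuousOn (fun s : ℝ => c (exp (s • b))) (Icc 0 δ) :=
      c.continuousOn.comp hcont.continuousOn hb
    have h2 : ContinuousOn (fun s : ℝ => s • b) (Icc 0 δ) :=
      Continuous.continuousOn (by fun_prop)
    have h3 := (h1.sub h2).preimage_isClosed_of_isClosed isClosed_Icc
      (isClosed_singleton (x := (0 : E)))
    convert h3 using 1
    ext s
    simp [hZ, sub_eq_zero, and_comm]
  · simp only [hZ, mem_ofPred_eq, zero_smul]
    exact hlog 0 hc0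
  · rintro s ⟨hs, hs'⟩
    have h1 : s • b ∈ c.target := by
      rw [← show c (exp (s • b)) = s • b from hs]
      exact c.map_source (hb s (Ico_subset_Icc_self hs'))
    have h2 : Continuous fun s : ℝ => s • b := by fun_prop
    refine mem_nhdsWithin_of_mem_nhds ?_
    filter_upwards [h2.continuousAt.eventually_mem (c.open_target.mem_nhds h1)] with r hr
    exact hlog _ hr

/-- Continuous homomorphisms map one-parameter subgroups to one-parameter subgroups. -/
lemma exists_forall_map_exp_smul [T2Space G]
    (hadd : ∀ (a : E) (s t : ℝ), exp ((s + t) • a) = exp (s • a) * exp (t • a))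
    (hexp : Continuous exp)
    (hc0 : (0 : E) ∈ c.target) (hcexp : ∀ a ∈ c.target, c.symm a = exp a)
    (α : G →* G) (hα : Continuous α) (a : E) :
    ∃ b : E, ∀ t : ℝ, α (exp (t • a)) = exp (t • b) := by
  have hlog : ∀ a ∈ c.target, c (exp a) = a := fun a ha => by
    rw [← hcexp a ha, c.right_inv ha]
  have hexpc : ∀ g ∈ c.source, exp (c g) = g := fun g hg => by
    rw [← hcexp _ (c.map_source hg), c.left_inv hg]
  have h0 := exp_zero_of_add hadd
  have h1s : (1 : G) ∈ c.source := by
    rw [← h0, ← hcexp 0 hc0]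
    exact c.map_target hc0
  have hc1 : c 1 = 0 := by rw [← h0, hlog 0 hc0]
  set X : ℝ → G := fun t => α (exp (t • a)) with hX
  have hXadd : ∀ s t, X (s + t) = X s * X t := fun s t => by simp only [hX, hadd, map_mul]
  have hXc : Continuous X := hα.comp (hexp.comp (by fun_prop))
  have hX0 : X 0 = 1 := by simp [hX, h0]
  have htwo : (fun b : E => (2 : ℝ) • b) ⁻¹' c.target ∈ 𝓝 (0 : E) := by
    have : Continuous fun b : E => (2 : ℝ) • b := by fun_prop
    exact this.continuousAt.preimage_mem_nhds (c.open_target.mem_nhds (by simpa using hc0))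
  have hev : ∀ᶠ t : ℝ in 𝓝 0, X t ∈ c.source ∧ (2 : ℝ) • c (X t) ∈ c.target := by
    refine (hXc.continuousAt.eventually_mem
      (c.open_source.mem_nhds (by rwa [hX0]))).and ?_
    have : ContinuousAt (fun t => c (X t)) 0 :=
      ContinuousAt.comp (g := c) (by rw [hX0]; exact c.continuousAt h1s) hXc.continuousAt
    exact this.eventually_mem (by rwa [hX0, hc1])
  obtain ⟨ε, hε, hball⟩ := Metric.eventually_nhds_iff.1 hev
  set δ := ε / 2 with hδ
  have hδ0 : 0 < δ := by positivity
  have hgood : ∀ t, 0 ≤ t → t ≤ δ → X t ∈ c.source ∧ (2 : ℝ) • c (X t) ∈ c.target := by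
    intro t ht ht'
    refine hball ?_
    rw [Real.dist_eq, sub_zero, abs_of_nonneg ht]
    linarith
  -- `2 • c (X (t / 2))` lies in the range of the logarithm and exponentiates to `X (t / 2) ^ 2 = X
  -- t`.
  have hhalf : ∀ t, 0 ≤ t → t ≤ δ → (2 : ℝ) • c (X (t / 2)) = c (X t) := by
    intro t ht ht'
    have h1 := hgood (t / 2) (by linarith) (by linarith)
    have h2 := hgood t ht ht'
    rw [← hlog _ h1.2]
    congr 1
    have h3 := hadd (c (X (t / 2))) 1 1
    rw [one_smul, hexpc _ h1.1, ← hXadd, add_halves, one_add_one_eq_two] at h3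
    exact h3
  have hpow : ∀ m : ℕ, c (X (δ / 2 ^ m)) = (1 / 2 ^ m : ℝ) • c (X δ) := by
    intro m
    induction m with
    | zero => simp
    | succ m ih =>
      have h1 := hhalf (δ / 2 ^ m) (by positivity)
        (div_le_self hδ0.le (one_le_pow₀ (by norm_num)))
      rw [ih, div_div, ← pow_succ] at h1
      have h2 := congrArg (fun y : E => (2⁻¹ : ℝ) • y) h1
      simp only [smul_smul] at h2
      norm_num at h2
      rw [h2]
      congr 1
      rw [pow_succ]
      field_simp
  refine ⟨δ⁻¹ • c (X δ), ?_⟩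
  set b := δ⁻¹ • c (X δ) with hb
  -- The times at which both one-parameter subgroups agree form a closed subgroup; it contains every
  -- `δ / 2 ^ m`, so it is dense and hence all of `ℝ`.
  let S : AddSubgroup ℝ :=
    { carrier := {t | X t = exp (t • b)}
      zero_mem' := by simp [hX0, h0]
      add_mem' := by
        intro s t hs ht
        rw [mem_ofPred_eq] at *
        rw [hXadd, hadd, hs, ht]
      neg_mem' := by
        intro t ht
        rw [mem_ofPred_eq] at *
        rw [exp_neg_of_add hadd, ← ht, eq_inv_iff_mul_eq_one, ← hXadd, neg_add_cancel, hX0] }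
  have hS : ∀ m : ℕ, δ / 2 ^ m ∈ S := by
    intro m
    change X (δ / 2 ^ m) = exp ((δ / 2 ^ m) • b)
    have h1 := hgood (δ / 2 ^ m) (by positivity)
      (div_le_self hδ0.le (one_le_pow₀ (by norm_num)))
    rw [← hexpc _ h1.1, hpow, hb, smul_smul]
    congr 2
    field_simp
  have hdense : Dense (S : Set ℝ) := by
    refine S.dense_of_not_isolated_zero fun ε' hε' => ?_
    obtain ⟨m, hm⟩ := exists_pow_lt_of_lt_one (div_pos hε' hδ0) (show (1 / 2 : ℝ) < 1 by norm_num)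
    refine ⟨δ / 2 ^ m, hS m, by positivity, ?_⟩
    rw [lt_div_iff₀ hδ0] at hm
    rw [one_div, inv_pow] at hm
    rwa [div_eq_inv_mul]
  have hcl : IsClosed {t : ℝ | X t = exp (t • b)} :=
    isClosed_eq hXc (hexp.comp (by fun_prop))
  intro t
  have h2 : closure (S : Set ℝ) ⊆ {t : ℝ | X t = exp (t • b)} :=
    closure_minimal (fun s hs => hs) hcl
  exact h2 (hdense t)

variable [ChartedSpace E G] [LocallyConvexSpace ℝ E]

/-- A Lie group automorphism has a derivative at `1`, and it intertwines the exponential map. -/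
lemma exists_isDerivAtOne [T2Space G]
    (hadd : ∀ (a : E) (s t : ℝ), exp ((s + t) • a) = exp (s • a) * exp (t • a))
    (hexp : Continuous exp)
    (hc0 : (0 : E) ∈ c.target) (hcexp : ∀ a ∈ c.target, c.symm a = exp a)
    (hder : ∀ a : E, HasDirDeriv (fun b => chartAt E (1 : G) (exp b)) 0 a a)
    {α : G ≃* G} (hα : IsSmoothSelfMap E (α : G → G)) :
    ∃ A : E →L[ℝ] E, IsDerivAtOne α A ∧ ∀ (a : E) (t : ℝ), α (exp (t • a)) = exp (t • A a) := by
  set e := chartAt E (1 : G) with he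
  have h1e : (1 : G) ∈ e.source := mem_chart_source E _
  obtain ⟨D, h0, hc, hd⟩ := hα.2 e (chart_mem_atlas E _) e (chart_mem_atlas E _)
  set s : Set E := {a | a ∈ e.target ∧ α (e.symm a) ∈ e.source} with hs
  have hso : IsOpen s := e.symm.isOpen_inter_preimage (e.open_source.preimage hα.1)
  rw [hso.interior_eq] at hd
  set f : E → E := fun a => e (α (e.symm a)) with hf
  set d : E → E → E := fun x v => D 1 x fun _ => v with hddef
  have hfd : ∀ x ∈ s, ∀ v, HasDirDeriv f x v (d x v) := by
    intro x hx v
    have h1 := hd 0 le_top x hx Fin.elim0 v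
    have h2 : (Fin.snoc (α := fun _ => E) Fin.elim0 v : Fin 1 → E) = fun _ => v := by
      ext1 l
      obtain rfl : l = Fin.last 0 := Fin.eq_zero l
      rw [Fin.snoc_last]
    rw [h2] at h1
    exact h1.congr' (hso.mem_nhds hx) fun y hy => h0 y hy _
  have hdc : ContinuousOn (fun q : E × E => d q.1 q.2) (s ×ˢ univ) := by
    refine (hc 1 le_top).comp (f := fun q : E × E => (q.1, fun _ : Fin 1 => q.2)) ?_
      fun q hq => ⟨hq.1, mem_univ _⟩
    exact Continuous.continuousOn (by fun_prop)
  have hx₀ : e 1 ∈ s := by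
    refine ⟨e.map_source h1e, ?_⟩
    rwa [e.left_inv h1e, map_one]
  let A : E →L[ℝ] E :=
    { toFun := d (e 1)
      map_add' := dirDeriv_add hso hfd hdc hx₀
      map_smul' := fun c v => dirDeriv_smul hso hfd hdc hx₀ c v
      cont := by
        rw [← continuousOn_univ]
        exact hdc.comp (continuousOn_const.prodMk continuousOn_id) fun v _ => ⟨hx₀, mem_univ _⟩ }
  refine ⟨A, fun v => hfd _ hx₀ v, fun a => ?_⟩
  obtain ⟨b, hb⟩ := exists_forall_map_exp_smul hadd hexp hc0 hcexp α.toMonoidHom hα.1 a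
  replace hb : ∀ t : ℝ, α (exp (t • a)) = exp (t • b) := hb
  have hexp0 := exp_zero_of_add hadd
  suffices hAb : A a = b by rw [hAb]; exact hb
  have hquot : ∀ a : E, Tendsto (fun t : ℝ => t⁻¹ • (e (exp (t • a)) - e 1)) (𝓝[≠] 0) (𝓝 a) := by
    intro a
    simpa [HasDirDeriv, hexp0] using hder a
  -- The curve `e (α (exp (t a)))` is differentiated at `0` twice: as the image of a curve with
  -- velocity `a` it gives `A a`, and as `e (exp (t b))` it gives `b`.
  have h1 := tendsto_slope_of_hasDirDeriv' hso hfd hdc hx₀ (tendsto_const_nhds (x := e 1))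
    (hquot a)
  refine tendsto_nhds_unique h1 ((hquot b).congr' ?_)
  have h2 : ∀ᶠ t : ℝ in 𝓝[≠] 0, exp (t • a) ∈ e.source := by
    have : Continuous fun t : ℝ => exp (t • a) := hexp.comp (by fun_prop)
    exact nhdsWithin_le_nhds (this.continuousAt.eventually_mem
      (e.open_source.mem_nhds (by simpa [hexp0] using h1e)))
  filter_upwards [self_mem_nhdsWithin, h2] with t ht hts
  rw [smul_smul, mul_inv_cancel₀ ht, one_smul, add_sub_cancel]
  simp only [hf]
  rw [e.left_inv hts, e.left_inv h1e, map_one, hb]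

end OneParameterSubgroups

/-! ### Regularity of families of Lie group automorphisms. -/

section Automorphisms

/-- Supplies the countable neighbourhood basis for the Baire argument; `W` is not assumed second
countable, but it is locally modelled on a subset of `ℝᵐ`. -/
lemma isCountablyGenerated_nhds_of_model {m : ℕ} {H : Type*} [TopologicalSpace H]
    (J : ModelWithCorners ℝ (EuclideanSpace ℝ (Fin m)) H) {W : Type*} [TopologicalSpace W]
    [ChartedSpace H W] (w : W) : (𝓝 w).IsCountablyGenerated := by
  have : FirstCountableTopology H := J.isClosedEmbedding.isInducing.firstCountableTopology
  rw [← (chartAt H w).symm_map_nhds_eq (mem_chart_source H w)]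
  infer_instance

variable {E : Type u} [AddCommGroup E] [Module ℝ E] [TopologicalSpace E]
  [IsTopologicalAddGroup E] [ContinuousSMul ℝ E] [LocallyConvexSpace ℝ E] [T2Space E]
  {G : Type*} [Group G] [TopologicalSpace G] [IsTopologicalGroup G] [T2Space G]
  [ChartedSpace E G]
  {m : ℕ} {H : Type*} [TopologicalSpace H]
  {J : ModelWithCorners ℝ (EuclideanSpace ℝ (Fin m)) H}
  {W : Type*} [TopologicalSpace W] [ChartedSpace H W]

/-- A family of Lie group automorphisms of a finite-dimensional Lie group is of class `𝓕` if all
its orbit maps are. -/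
lemma isClassMapLieAut_of_isClassMap_apply [FiniteDimensional ℝ E] (hG : IsLocallyExponential E G)
    {𝓕 : SmoothnessClass} (h𝓕 : 𝓕.Admissible m E) {γ : W → LieAut E G}
    (hγ : ∀ g : G, IsClassMap 𝓕 J E fun w => (γ w).1 g) : IsClassMapLieAut 𝓕 J E γ := by
  obtain ⟨exp, hexp, -, hadd, hder, c, hc, hc0, hcexp⟩ := hG
  choose A hA hAexp using fun w =>
    exists_isDerivAtOne hadd hexp hc0 hcexp hder (γ w).2.1
  refine ⟨A, hA, fun w₀ => ?_⟩
  have hcg := isCountablyGenerated_nhds_of_model J w₀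
  have h1s : c.source ∈ 𝓝 (1 : G) := by
    refine c.open_source.mem_nhds ?_
    rw [← exp_zero_of_add hadd, ← hcexp 0 hc0]
    exact c.map_target hc0
  set b := Module.finBasis ℝ E with hb
  have hδ : ∀ i, ∃ δ > 0, ∀ᶠ w in 𝓝 w₀, ∀ s ∈ Icc (0 : ℝ) δ,
      (γ w).1 (exp (s • b i)) ∈ c.source := fun i =>
    exists_eventually_forall_mem_of_pointwise (X := fun w t => (γ w).1 (exp (t • b i)))
      (fun w s t => by rw [hadd, map_mul])
      (fun w => (γ w).2.1.1.comp (hexp.comp (by fun_prop)))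
      (fun t => (hγ (exp (t • b i))).1.continuousAt) h1s
  choose δ hδ0 hδ using hδ
  -- Rank-one maps `x ↦ coord i ⊗ (δ i)⁻¹ x`: they rebuild `A w` from its values on the basis, given
  -- the logarithms `δ i • A w (b i)`.
  set Λ : Fin (Module.finrank ℝ E) → E →L[ℝ] (E →L[ℝ] E) := fun i =>
    LinearMap.toContinuousLinearMap
      { toFun := fun x => (LinearMap.toContinuousLinearMap (b.coord i)).smulRight ((δ i)⁻¹ • x)
        map_add' := fun x y => by ext; simp
        map_smul' := fun r x => by
          ext
          simp only [ContinuousLinearMap.smulRight_apply, smul_apply,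
            RingHom.id_apply]
          rw [smul_comm r, smul_comm r] } with hΛ
  refine ClassNear.sum_clm h𝓕 (f := fun i w => c ((γ w).1 (exp (δ i • b i)))) (fun i => ?_) Λ ?_
  · exact (hγ (exp (δ i • b i))).2 w₀ c hc
      ((hδ i).self_of_nhds (δ i) ⟨(hδ0 i).le, le_rfl⟩)
  · filter_upwards [eventually_all.2 hδ] with w hw
    have hlog : ∀ i, c ((γ w).1 (exp (δ i • b i))) = δ i • A w (b i) := fun i => by
      rw [hAexp w (b i) (δ i)]
      refine chart_exp_smul_of_forall_mem hexp hc0 hcexp (fun s hs => ?_) (δ i)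
        ⟨(hδ0 i).le, le_rfl⟩
      rw [← hAexp w (b i) s]
      exact hw i s hs
    ext x
    conv_lhs => rw [← b.sum_repr x]
    simp only [map_sum, map_smul, sum_apply, hlog]
    refine Finset.sum_congr rfl fun i _ => ?_
    have := (hδ0 i).ne'
    have hx : b.repr x i = δ i * (b.repr x i * (δ i)⁻¹) := by field_simp
    simp [hΛ, smul_smul, ← hx]

end Automorphisms

/-! ### The algebra of weighted composition operators. -/

section WeightedComposition

set_option linter.unusedSectionVars false

variable {𝓕 : SmoothnessClass} {n : ℕ} {H : Type*} [TopologicalSpace H]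
  {I : ModelWithCorners ℝ (EuclideanSpace ℝ (Fin n)) H}
  {V : Type*} [TopologicalSpace V] [ChartedSpace H V]
  {E : Type*} [AddCommGroup E] [Module ℝ E] [TopologicalSpace E]
  {G : Type*} [Group G] [TopologicalSpace G] [IsTopologicalGroup G] [ChartedSpace E G]

lemma range_constHom_ne_univ [Nontrivial G] (g : G) :
    range (constHom 𝓕 I V E G g : V → G) ≠ univ := by
  intro h
  obtain ⟨g', hg'⟩ := exists_ne g
  obtain ⟨v, hv⟩ := h.symm ▸ mem_univ g'
  exact hg' hv.symm

/-- A homomorphism that fixes the constants and is an evaluation on the classes of non-surjective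
maps differs from that evaluation by a central homomorphism. -/
lemma exists_center_hom_of_eval [Nontrivial G] {h : mappingGroup 𝓕 I V E G →* G}
    (hconst : ∀ g, h (constHom 𝓕 I V E G g) = g) {v : V}
    (hv : ∀ x₀ : mappingGroup 𝓕 I V E G, range (x₀ : V → G) ≠ univ →
      ∀ x : mappingGroup 𝓕 I V E G,
        (x : mappingGroup 𝓕 I V E G ⧸ nullGroup 𝓕 I V E G) = x₀ → h x = (x : V → G) v) :
    ∃ ψ : (mappingGroup 𝓕 I V E G ⧸ nullGroup 𝓕 I V E G) →* Subgroup.center G,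
      (∀ x₀ : mappingGroup 𝓕 I V E G, range (x₀ : V → G) ≠ univ → ψ x₀ = 1) ∧
      ∀ x : mappingGroup 𝓕 I V E G, h x = (ψ x : G) * (x : V → G) v := by
  -- For `g ≠ 1` the map `x g x⁻¹` omits `1`, so it is not surjective and `h` evaluates it at `v`,
  -- whatever `x` is.
  have hcomm : ∀ (x : mappingGroup 𝓕 I V E G) (g : G),
      h x * g * (h x)⁻¹ = (x : V → G) v * g * ((x : V → G) v)⁻¹ := by
    intro x g
    rcases eq_or_ne g 1 with rfl | hg
    · simp
    have h1 := hv (x * constHom 𝓕 I V E G g * x⁻¹) (fun hr => ?_) _ rfl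
    · rw [map_mul, map_mul, map_inv, hconst] at h1
      exact h1
    · obtain ⟨w, hw⟩ := hr.symm ▸ mem_univ (1 : G)
      have hw' : (x : V → G) w * g * ((x : V → G) w)⁻¹ = 1 := hw
      exact hg (by simpa using hw')
  have hcent : ∀ x : mappingGroup 𝓕 I V E G,
      ((x : V → G) v)⁻¹ * h x ∈ Subgroup.center G := by
    intro x
    rw [Subgroup.mem_center_iff]
    intro g
    have h1 := hcomm x g
    rw [mul_inv_eq_iff_eq_mul] at h1
    calc g * (((x : V → G) v)⁻¹ * h x)
        = ((x : V → G) v)⁻¹ * ((x : V → G) v * g * ((x : V → G) v)⁻¹ * h x) := by group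
      _ = ((x : V → G) v)⁻¹ * h x * g := by rw [← h1]; group
  let ψ₀ : mappingGroup 𝓕 I V E G →* Subgroup.center G :=
    { toFun := fun x => ⟨((x : V → G) v)⁻¹ * h x, hcent x⟩
      map_one' := by ext; simp
      map_mul' := fun x y => by
        ext
        have h1 := (Subgroup.mem_center_iff.1 (hcent x)) ((y : V → G) v)⁻¹
        simp only [Subgroup.coe_mul, Pi.mul_apply, mul_inv_rev, map_mul]
        rw [← mul_assoc (((x : V → G) v)⁻¹ * h x), ← h1]
        group }
  -- The null group is the class of the constant `1`, which is not surjective because `G` is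
  -- nontrivial.
  have hker : nullGroup 𝓕 I V E G ≤ ψ₀.ker := by
    intro x hx
    rw [MonoidHom.mem_ker]
    ext
    have h1 := hv 1 (range_constHom_ne_univ (𝓕 := 𝓕) (I := I) (V := V) (E := E) (1 : G)) x
      ((QuotientGroup.eq_one_iff x).2 hx)
    simp [ψ₀, h1]
  refine ⟨QuotientGroup.lift _ ψ₀ hker, fun x₀ hx₀ => ?_, fun x => ?_⟩
  · rw [QuotientGroup.lift_mk]
    ext
    simp [ψ₀, hv x₀ hx₀ x₀ rfl]
  · rw [QuotientGroup.lift_mk, ← Subgroup.mem_center_iff.1 (ψ₀ x).2]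
    simp [ψ₀]

lemma IsWeightedComposition.apply_of_range_ne_univ {W : Type*}
    {f : mappingGroup 𝓕 I V E G →* (W → G)} {φ : W → V} {γ : W → MulAut G}
    {ψ : W → (mappingGroup 𝓕 I V E G ⧸ nullGroup 𝓕 I V E G) →* Subgroup.center G}
    (hf : IsWeightedComposition f φ γ ψ) {x : mappingGroup 𝓕 I V E G}
    (hx : range (x : V → G) ≠ univ) (w : W) : f x w = γ w ((x : V → G) (φ w)) := by
  rw [hf.2, hf.1 w x hx, Subgroup.coe_one, one_mul]

lemma IsWeightedComposition.apply_const [Nontrivial G] {W : Type*}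
    {f : mappingGroup 𝓕 I V E G →* (W → G)} {φ : W → V} {γ : W → MulAut G}
    {ψ : W → (mappingGroup 𝓕 I V E G ⧸ nullGroup 𝓕 I V E G) →* Subgroup.center G}
    (hf : IsWeightedComposition f φ γ ψ) (g : G) (w : W) :
    f (constHom 𝓕 I V E G g) w = γ w g :=
  hf.apply_of_range_ne_univ (range_constHom_ne_univ g) w

/-- Homomorphisms that preserve the maps omitting `1` are weighted composition operators, if range
decreasing homomorphisms are evaluations. -/
lemma exists_isWeightedComposition [Nontrivial G] {W : Type*}
    (hrange : ∀ h : mappingGroup 𝓕 I V E G →* G, IsRangeDecreasing h → IsNontrivialOnNull h →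
      IsEvalOnNonsurjectiveClasses h)
    {f : mappingGroup 𝓕 I V E G →* (W → G)} (hnull : ∀ w, IsNontrivialOnNull (evalComp f w))
    (hsurj : ∀ w, Function.Surjective fun g : G => f (constHom 𝓕 I V E G g) w)
    (hone : ∀ x : mappingGroup 𝓕 I V E G, (∀ v, (x : V → G) v ≠ 1) → ∀ w, f x w ≠ 1) :
    ∃ (φ : W → V) (γ : W → MulAut G)
      (ψ : W → (mappingGroup 𝓕 I V E G ⧸ nullGroup 𝓕 I V E G) →* Subgroup.center G),
      IsWeightedComposition f φ γ ψ := by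
  have hinj : ∀ w, Function.Injective ((evalComp f w).comp (constHom 𝓕 I V E G)) := by
    intro w
    rw [injective_iff_map_eq_one]
    intro g hg
    by_contra hne
    exact hone (constHom 𝓕 I V E G g) (fun _ => hne) w hg
  let γ : W → MulAut G := fun w =>
    MulEquiv.ofBijective ((evalComp f w).comp (constHom 𝓕 I V E G)) ⟨hinj w, hsurj w⟩
  have hγ : ∀ w g, γ w g = f (constHom 𝓕 I V E G g) w := fun _ _ => rfl
  let h : W → mappingGroup 𝓕 I V E G →* G := fun w => (γ w).symm.toMonoidHom.comp (evalComp f w)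
  have hh : ∀ w x, γ w (h w x) = f x w := fun w x => (γ w).apply_symm_apply _
  have hconst : ∀ w g, h w (constHom 𝓕 I V E G g) = g := fun w g =>
    (γ w).injective (by rw [hh, hγ])
  -- If `h w x` is not a value of `x`, then `x · (h w x)⁻¹` omits `1` but is sent to `1` at `w`.
  have hdecr : ∀ w, IsRangeDecreasing (h w) := by
    intro w x
    by_contra hx
    refine hone (x * (constHom 𝓕 I V E G (h w x))⁻¹) (fun v hv => hx ⟨v, ?_⟩) w ?_
    · exact mul_inv_eq_one.1 hv
    · rw [← hh, map_mul, map_inv, hconst, mul_inv_cancel, map_one]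
  have hnt : ∀ w, IsNontrivialOnNull (h w) := by
    intro w
    obtain ⟨y, hy, hne⟩ := hnull w
    refine ⟨y, hy, fun h1 => hne ?_⟩
    change f y w = 1
    rw [← hh, h1, map_one]
  choose φ hφ using fun w => hrange (h w) (hdecr w) (hnt w)
  choose ψ hψ hψ' using fun w => exists_center_hom_of_eval (hconst w) (hφ w)
  refine ⟨φ, γ, ψ, hψ, fun x w => ?_⟩
  rw [← hψ', hh]

end WeightedComposition

/-- Near `0` the exponential map is injective, and the nonzero space `E` has nonzero vectors
arbitrarily close to `0`. This makes `G` nontrivial, so constants are never surjective. -/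
lemma IsLocallyExponential.exists_exp_ne_one {E G : Type*} [AddCommGroup E] [Module ℝ E]
    [TopologicalSpace E] [ContinuousSMul ℝ E] [Nontrivial E] [Group G] {exp : E → G}
    [TopologicalSpace G] (h0 : exp 0 = 1) {c : OpenPartialHomeomorph G E} (hc0 : (0 : E) ∈ c.target)
    (hcexp : ∀ a ∈ c.target, c.symm a = exp a) : ∃ a, exp a ≠ 1 := by
  obtain ⟨a, ha⟩ := exists_ne (0 : E)
  have h1 : Tendsto (fun t : ℝ => t • a) (𝓝[≠] 0) (𝓝 0) := by
    have h : Continuous fun t : ℝ => t • a := by fun_prop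
    simpa using (h.tendsto 0).mono_left nhdsWithin_le_nhds
  obtain ⟨t, ht, ht0⟩ :=
    ((h1.eventually_mem (c.open_target.mem_nhds hc0)).and self_mem_nhdsWithin).exists
  refine ⟨t • a, fun h => smul_ne_zero ht0 ha ?_⟩
  rw [← c.right_inv ht, hcexp _ ht, h, ← h0, ← hcexp 0 hc0, c.right_inv hc0]

end MapGroup

end

/-! ### The equivalence and the regularity of the automorphism factor. -/

open MapGroup in
theorem corollary2p4
    -- the locally exponential connected Lie group `G` modelled on `E`
    {E : Type*} [AddCommGroup E] [Module ℝ E] [TopologicalSpace E] [IsTopologicalAddGroup E]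
    [ContinuousSMul ℝ E] [LocallyConvexSpace ℝ E] [T2Space E] [Nontrivial E]
    (hE : IsSeqComplete E)
    {G : Type*} [Group G] [TopologicalSpace G] [IsTopologicalGroup G] [T2Space G]
    [ConnectedSpace G] [ChartedSpace E G]
    (hG : IsMBLieGroup E G) (hGexp : IsLocallyExponential E G)
    -- the manifolds `V` and `W`, of dimensions `n ≥ 1` and `m ≥ 0`
    {n : ℕ} (hn : 1 ≤ n) {H : Type*} [TopologicalSpace H]
    (I : ModelWithCorners ℝ (EuclideanSpace ℝ (Fin n)) H) (hI : IsBoundaryModel I)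
    {V : Type*} [TopologicalSpace V] [T2Space V] [ChartedSpace H V] [IsManifold I ∞ V]
    {m : ℕ} {H' : Type*} [TopologicalSpace H']
    (J : ModelWithCorners ℝ (EuclideanSpace ℝ (Fin m)) H') (hJ : IsBoundaryModel J)
    {W : Type*} [TopologicalSpace W] [T2Space W] [ChartedSpace H' W] [IsManifold J ∞ W]
    -- the smoothness classes
    (𝓕 𝓕' : SmoothnessClass) (h𝓕 : 𝓕.Admissible n E) (h𝓕' : 𝓕'.Admissible m E)
    -- the assumption on range decreasing homomorphisms
    (hrange : ∀ h : mappingGroup 𝓕 I V E G →* G, IsRangeDecreasing h → IsNontrivialOnNull h →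
      IsEvalOnNonsurjectiveClasses h)
    -- a homomorphism from `𝓕(V, G)` to the maps `W → G`, whose values are `𝓕'` maps
    (f : mappingGroup 𝓕 I V E G →* (W → G)) (hf : ∀ x, IsClassMap 𝓕' J E (f x)) :
    (((∀ w : W, IsNontrivialOnNull (evalComp f w) ∧
          Function.Surjective (fun g : G => f (constHom 𝓕 I V E G g) w)) ∧
        (∀ x : mappingGroup 𝓕 I V E G, (∀ v, (x : V → G) v ≠ 1) → ∀ w, f x w ≠ 1)) ↔
      ∃ (φ : W → V) (γ : W → MulAut G)
        (ψ : W → (mappingGroup 𝓕 I V E G ⧸ nullGroup 𝓕 I V E G) →* Subgroup.center G),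
        IsWeightedComposition f φ γ ψ) ∧
    (∀ (φ : W → V) (γ : W → MulAut G)
        (ψ : W → (mappingGroup 𝓕 I V E G ⧸ nullGroup 𝓕 I V E G) →* Subgroup.center G),
        IsWeightedComposition f φ γ ψ →
      FiniteDimensional ℝ E →
      (∀ w, ∃ α : LieAut E G, ∀ g : G, f (constHom 𝓕 I V E G g) w = α.1 g) →
      ∃ γ' : W → LieAut E G, (∀ w, (γ' w).1 = γ w) ∧ IsClassMapLieAut 𝓕' J E γ') := by
  obtain ⟨exp, hexp, hsm, hadd, -, c, -, hc0, hcexp⟩ := id hGexp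
  have h0 := exp_zero_of_add hadd
  obtain ⟨a, ha⟩ := IsLocallyExponential.exists_exp_ne_one h0 hc0 hcexp
  have : Nontrivial G := ⟨⟨exp a, 1, ha⟩⟩
  refine ⟨⟨?_, ?_⟩, ?_⟩
  · rintro ⟨hw, hone⟩
    exact exists_isWeightedComposition hrange (fun w => (hw w).1) (fun w => (hw w).2) hone
  · rintro ⟨φ, γ, ψ, hfγ⟩
    refine ⟨fun w => ⟨?_, fun g => ?_⟩, fun x hx w => ?_⟩
    -- On the null group `ψ` is trivial, so a null-homotopic map with value `exp a ≠ 1` at `φ w` is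
    -- not sent to `1` at `w`.
    · obtain ⟨y, hy, hya⟩ :=
        exists_mem_nullGroup_apply_eq_exp (I := I) h𝓕 hexp h0 hsm (φ w) a
      refine ⟨y, hy, fun h1 => ha ?_⟩
      have h2 : f y w = γ w ((y : V → G) (φ w)) := by
        have h3 : (y : mappingGroup 𝓕 I V E G ⧸ nullGroup 𝓕 I V E G) = 1 :=
          (QuotientGroup.eq_one_iff y).2 hy
        rw [hfγ.2, h3, map_one, Subgroup.coe_one, one_mul]
      rw [← hya]
      exact (map_eq_one_iff (γ w) (γ w).injective).1 (h2.symm.trans h1)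
    · exact ⟨(γ w).symm g, by
        change f (constHom 𝓕 I V E G ((γ w).symm g)) w = g
        rw [hfγ.apply_const, MulEquiv.apply_symm_apply]⟩
    · have hx1 : range (x : V → G) ≠ univ := fun h => by
        obtain ⟨v, hv⟩ := h.symm ▸ mem_univ (1 : G)
        exact hx v hv
      rw [hfγ.apply_of_range_ne_univ hx1 w]
      exact (map_ne_one_iff (γ w) (γ w).injective).2 (hx _)
  · intro φ γ ψ hfγ _ hα
    choose α hα using hα
    have hαγ : ∀ w, (α w).1 = γ w := fun w =>
      MulEquiv.ext fun g => by rw [← hα w g, hfγ.apply_const]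
    refine ⟨α, hαγ, isClassMapLieAut_of_isClassMap_apply hGexp h𝓕' fun g => ?_⟩
    have h1 : (fun w => (α w).1 g) = f (constHom 𝓕 I V E G g) := funext fun w => (hα w g).symm
    rw [h1]
    exact hf _
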